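/- Let $d\in\mathbb{N}$, $\alpha\in(0,1)$, $\rho>0$, $t_0>0$, let $A\in\mathbb{R}^{d\times d}$, and let $f:\mathbb{R}^d\to\mathbb{R}^d$ be locally Lipschitz continuous. The Caputo–Katugampola derivative of order $\alpha$ of a function $u$ is $$ {}^{C}D^{\alpha,\rho}_{t_0^+}u(t)=\frac{\rho^{\alpha}}{\Gamma(1-\alpha)}\,t^{1-\rho}\,\frac{d}{dt}\int_{t_0}^{t}\frac{s^{\rho-1}\,[u(s)-u(t_0)]}{(t^{\rho}-s^{\rho})^{\alpha}}\,ds ,$$ where $d/dt$ is the right derivative at $t=t_0$. Consider the system $$ {}^{C}D^{\alpha,\rho}_{t_0^+}x(t)=Ax(t)+f(x(t)),\qquad t\ge t_0. \tag{1}$$ A solution of (1) on $[t_0,T)$, $t_0<T\le\infty$, is a continuous function $x:[t_0,T)\to\mathbb{R}^d$ whose Caputo–Katugampola derivative exists and satisfies (1) at every $t\in[t_0,T)$. The maximal solution with initial value $x_0$, denoted $x(\cdot,x_0):[t_0,t_{\max}(x_0))\to\mathbb{R}^d$, is the solution with $x(t_0)=x_0$ of which every other solution with the same initial value is a restriction.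 For $r>0$ put $$\ell_f(r)=\sup_{\|x\|,\|y\|\le r,\ x\ne y}\frac{\|f(x)-f(y)\|}{\|x-y\|}.$$ Theorem. Assume that every eigenvalue $\lambda\in\mathbb{C}$ of $A$ satisfies $\lambda\neq 0$ and $|\arg\lambda|>\alpha\pi/2$ (with $\arg\lambda\in(-\pi,\pi]$), that $f(0)=0$, and that $\lim_{r\to0^+}\ell_f(r)=0$. Then the zero solution of (1) is asymptotically stable, that is: (i) for every $\varepsilon>0$ there is $\delta>0$ such that for every $x_0\in\mathbb{R}^d$ with $\|x_0\|\le\delta$ the maximal solution $x(\cdot,x_0)$ exists, $t_{\max}(x_0)=\infty$, and $\|x(t,x_0)\|\le\varepsilon$ for all $t\ge t_0$; (ii) there is $c>0$ such that for every $x_0\in\mathbb{R}^d$ with $\|x_0\|\le c$ the maximal solution $x(\cdot,x_0)$ exists, $t_{\max}(x_0)=\infty$, and $\lim_{t\to\infty}x(t,x_0)=0$. -/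

import Mathlib

namespace CaputoKatugampola

/-- The Katugampola fractional derivative of order `α ∈ (0,1)` with parameter `ρ` and base point `a`
of the function `u` exists at `t` and is equal to `v`:
`v = ρ ^ α / Γ(1 - α) * t ^ (1 - ρ) * d/dt ∫ s in a..t, s ^ (ρ - 1) * u s / (t ^ ρ - s ^ ρ) ^ α`.
The `t`-derivative is required to exist; it is taken within `[a, ∞)`, that is, it is the usual
derivative for `t > a` and the right derivative for `t = a`. -/
def HasKatugampolaDerivAt {E : Type*} [NormedAddCommGroup E] [NormedSpace ℝ E]
    (α ρ a : ℝ) (u : ℝ → E) (v : E) (t : ℝ) : Prop :=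
  ∃ w : E,
    HasDerivWithinAt
      (fun τ : ℝ => ∫ s in a..τ, (s ^ (ρ - 1) / (τ ^ ρ - s ^ ρ) ^ α) • u s) w (Set.Ici a) t ∧
    v = (ρ ^ α / Real.Gamma (1 - α) * t ^ (1 - ρ)) • w

/-- The Caputo–Katugampola fractional derivative of `u` exists at `t` and equals `v`: it is the
Katugampola derivative of `u - u a`. -/
def HasCaputoKatugampolaDerivAt {E : Type*} [NormedAddCommGroup E] [NormedSpace ℝ E]
    (α ρ a : ℝ) (u : ℝ → E) (v : E) (t : ℝ) : Prop :=
  HasKatugampolaDerivAt α ρ a (fun s => u s - u a) v t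

/-- `x` is a (continuous) solution on `[t₀, T)`, where `t₀ < T ≤ ∞`, of the initial value problem
`ᶜD^{α,ρ} x = g(x)`, `x(t₀) = x₀`. The values of `x` outside `[t₀, T)` are irrelevant. -/
structure IsSolution {E : Type*} [NormedAddCommGroup E] [NormedSpace ℝ E]
    (α ρ t₀ : ℝ) (g : E → E) (x₀ : E) (T : EReal) (x : ℝ → E) : Prop where
  lt : (t₀ : EReal) < T
  continuousOn : ContinuousOn x {t : ℝ | t₀ ≤ t ∧ (t : EReal) < T}
  initial : x t₀ = x₀
  equation : ∀ t : ℝ, t₀ ≤ t → (t : EReal) < T → HasCaputoKatugampolaDerivAt α ρ t₀ x (g (x t)) t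

/-- `x` on `[t₀, T)` is the solution on its maximal interval of existence: it is a solution, and
every solution `y` on some `[t₀, S)` with the same initial value is a restriction of it. This
determines `T`, and `x` on `[t₀, T)`, uniquely. -/
structure IsMaximalSolution {E : Type*} [NormedAddCommGroup E] [NormedSpace ℝ E]
    (α ρ t₀ : ℝ) (g : E → E) (x₀ : E) (T : EReal) (x : ℝ → E) : Prop where
  isSolution : IsSolution α ρ t₀ g x₀ T x
  maximal : ∀ (S : EReal) (y : ℝ → E), IsSolution α ρ t₀ g x₀ S y →
    S ≤ T ∧ Set.EqOn y x {t : ℝ | t₀ ≤ t ∧ (t : EReal) < S}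

/-- The equilibrium `0` of `ᶜD^{α,ρ} x = g(x)` is stable. -/
def IsStable {E : Type*} [NormedAddCommGroup E] [NormedSpace ℝ E]
    (α ρ t₀ : ℝ) (g : E → E) : Prop :=
  ∀ ε > 0, ∃ δ > 0, ∀ x₀ : E, ‖x₀‖ ≤ δ →
    ∃ (T : EReal) (x : ℝ → E), IsMaximalSolution α ρ t₀ g x₀ T x ∧
      T = ⊤ ∧ ∀ t : ℝ, t₀ ≤ t → ‖x t‖ ≤ ε

/-- The equilibrium `0` of `ᶜD^{α,ρ} x = g(x)` is asymptotically stable: it is stable, and all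
solutions with small enough initial value are global and converge to `0`. -/
def IsAsymptoticallyStable {E : Type*} [NormedAddCommGroup E] [NormedSpace ℝ E]
    (α ρ t₀ : ℝ) (g : E → E) : Prop :=
  IsStable α ρ t₀ g ∧
  ∃ c > 0, ∀ x₀ : E, ‖x₀‖ ≤ c →
    ∃ (T : EReal) (x : ℝ → E), IsMaximalSolution α ρ t₀ g x₀ T x ∧
      T = ⊤ ∧ Filter.Tendsto x Filter.atTop (nhds 0)

/-- The best Lipschitz constant `ℓ_f(r) = sup ‖f x - f y‖ / ‖x - y‖` of `f` on the ball of
radius `r` about `0`, as an extended nonnegative real (`0 / 0 = 0` there, so the pairs with `x = y`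
do not contribute). -/
noncomputable def lipConst {E : Type*} [NormedAddCommGroup E] (f : E → E) (r : ℝ) : ENNReal :=
  ⨆ x ∈ Metric.closedBall (0 : E) r, ⨆ y ∈ Metric.closedBall (0 : E) r,
    edist (f x) (f y) / edist x y

end CaputoKatugampola

/-! The substitution `τ = (t ^ ρ - t₀ ^ ρ) / ρ` turns the Caputo–Katugampola derivative into the
ordinary Caputo derivative. Integrated once, the equation reads `k * (x - x₀) = ∫ (A x + f x)`,
where `k` is `abelKernel α` and `*` is convolution on the half-line. If `S` has Laplace transform
`(p ^ α - A)⁻¹`, this is equivalent to the Volterra equation `x = x₀ + S * (A x₀ + f x)`.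

The decisive fact is that `S` is integrable on the half-line
(`exists_integrableOn_laplace_eq_resolvent`). It is an inverse Laplace integral over the rays `arg z
= ±φ` with `φ` slightly larger than `π / 2`; the spectral condition leaves room for such rays.
Writing `z = e ^ w` makes the rays horizontal lines. The `L¹` norm of `S` is then controlled by the
integral of the resolvent along these lines, once the resolvent has been corrected by an explicit
term so that it decays at both ends. Letting `p → 0` gives `(∫ S) A = -1`, and Lerch's theorem gives
`k * S = 1 + A ∫ S = 1 + (∫ S) A`, which yields the equivalence above
(`integral_smul_eq_of_eq_opConv`, `eq_opConv_of_integral_smul_eq`).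

The linear part `x₀ + (∫₀ᵗ S) A x₀` tends to `x₀ - x₀ = 0`. Near the origin the Lipschitz constant
of `f` times `‖S‖₁` is at most `1 / 2`, so the Volterra map, with `f` replaced by a global Lipschitz
extension, contracts the space of continuous functions vanishing at infinity
(`exists_volterra_solution`). Its fixed point is global, of size `O(‖x₀‖)` and tends to `0`; it
stays in the ball where the extension equals `f`. Any other solution agrees with it by a first-exit
argument (`eqOn_of_volterra_eq`), which gives maximality. -/

namespace CaputoKatugampola

open MeasureTheory Set Filter Topology FourierTransform

/-! ### Injectivity of the Fourier and Laplace transforms -/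

/-- An integrable function with vanishing Fourier transform vanishes almost everywhere. -/
theorem ae_eq_zero_of_fourier_eq_zero {F : Type*} [NormedAddCommGroup F] [NormedSpace ℂ F]
    [CompleteSpace F] {f : ℝ → F} (hf : Integrable f) (h : ∀ ξ, 𝓕 f ξ = 0) :
    ∀ᵐ x, f x = 0 := by
  refine ae_eq_zero_of_integral_contDiff_smul_eq_zero hf.locallyIntegrable fun g hg hgs => ?_
  have hgc : ContDiff ℝ (↑(⊤ : ℕ∞)) fun x => (g x : ℂ) := Complex.ofRealCLM.contDiff.comp hg
  have hgs' : HasCompactSupport fun x => (g x : ℂ) := hgs.comp_left (g := fun r : ℝ => (r : ℂ)) rfl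
  set G : SchwartzMap ℝ ℂ := hgs'.toSchwartzMap hgc with hG
  set K : SchwartzMap ℝ ℂ := 𝓕⁻ G with hK
  have hGK : 𝓕 K = G := FourierTransform.fourier_fourierInv_eq G
  -- Multiplication formula `∫ 𝓕K • f = ∫ K • 𝓕f`. The test function is `g = 𝓕K`, and the right side
  -- vanishes.
  have key := VectorFourier.integral_fourierIntegral_smul_eq_flip (L := innerₗ ℝ)
    (e := Real.fourierChar) (μ := volume) (ν := volume)
    Real.continuous_fourierChar continuous_inner K.integrable hf
  have h1 : ∀ ξ, VectorFourier.fourierIntegral Real.fourierChar volume (innerₗ ℝ) K ξ = g ξ := by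
    intro ξ
    have : (𝓕 (K : ℝ → ℂ)) ξ = G ξ := by rw [← SchwartzMap.fourier_coe, hGK]
    exact this
  have h2 : ∀ ξ, VectorFourier.fourierIntegral Real.fourierChar volume (innerₗ ℝ) f ξ = 0 := by
    intro ξ
    rw [← h ξ]
    rfl
  simpa [h1, h2] using key

section Laplace

variable {F : Type*} [NormedAddCommGroup F] [NormedSpace ℂ F]

theorem integrableOn_cexp_smul {f : ℝ → F}
    (hf : ∀ c : ℝ, 0 < c → IntegrableOn (fun t : ℝ => Complex.exp (-(c : ℂ) * t) • f t) (Ioi 0))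
    {p : ℂ} (hp : 0 < p.re) :
    IntegrableOn (fun t : ℝ => Complex.exp (-p * t) • f t) (Ioi 0) := by
  have h := hf p.re hp
  have : (fun t : ℝ => Complex.exp (-p * t) • f t) =
      fun t : ℝ => Complex.exp (-(Complex.I * p.im) * t) •
        (Complex.exp (-(p.re : ℂ) * t) • f t) := by
    ext t
    rw [smul_smul, ← Complex.exp_add]
    congr 2
    conv_lhs => rw [← Complex.re_add_im p]
    ring
  rw [this]
  refine (integrable_norm_iff ?_).1 ?_
  · exact AEStronglyMeasurable.smul (by fun_prop) h.aestronglyMeasurable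
  · refine h.norm.congr (Eventually.of_forall fun t => ?_)
    simp only [norm_smul (Complex.exp (-(Complex.I * p.im) * t))]
    rw [Complex.norm_exp]
    simp

theorem differentiableOn_laplace {f : ℝ → F}
    (hf : ∀ c : ℝ, 0 < c → IntegrableOn (fun t : ℝ => Complex.exp (-(c : ℂ) * t) • f t) (Ioi 0)) :
    DifferentiableOn ℂ (fun p : ℂ => ∫ t in Ioi (0 : ℝ), Complex.exp (-p * t) • f t)
      {p | 0 < p.re} := by
  intro p hp
  have hp : 0 < p.re := hp
  set r := p.re / 2 with hr
  have hr0 : 0 < r := by positivity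
  have hfm : AEStronglyMeasurable f (volume.restrict (Ioi 0)) := by
    have h := (hf 1 one_pos).aestronglyMeasurable
    have : f = fun t : ℝ => Complex.exp (((1 : ℝ) : ℂ) * (t : ℂ)) •
        (Complex.exp (-((1 : ℝ) : ℂ) * t) • f t) := by
      ext t
      rw [smul_smul, ← Complex.exp_add]
      simp
    rw [this]
    exact AEStronglyMeasurable.smul (by fun_prop) h
  refine (hasDerivAt_integral_of_dominated_loc_of_deriv_le (s := Metric.ball p r)
    (F := fun (p : ℂ) (t : ℝ) => Complex.exp (-p * t) • f t)
    (F' := fun (p : ℂ) (t : ℝ) => (-(t : ℂ) * Complex.exp (-p * t)) • f t)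
    -- On the ball `Re q > r`. Half of this exponential rate absorbs the factor `t` produced by
    -- differentiation, the other half remains integrable.
    (bound := fun t : ℝ => (1 / (r / 2)) * ‖Complex.exp (-((r / 2 : ℝ) : ℂ) * t) • f t‖)
    (Metric.ball_mem_nhds p hr0) ?_ (integrableOn_cexp_smul hf hp) ?_ ?_ ?_
    ?_).2.differentiableAt.differentiableWithinAt
  · exact Eventually.of_forall fun q => AEStronglyMeasurable.smul (by fun_prop) hfm
  · exact AEStronglyMeasurable.smul (by fun_prop) hfm
  · refine (ae_restrict_mem measurableSet_Ioi).mono fun t ht q hq => ?_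
    have ht : 0 < t := ht
    have hq' : r < q.re := by
      have h1 := Complex.abs_re_le_norm (q - p)
      have h2 : ‖q - p‖ < r := by simpa [dist_eq_norm] using hq
      have h3 := (abs_lt.1 (h1.trans_lt h2)).1
      simp only [Complex.sub_re] at h3
      linarith
    rw [norm_smul, norm_smul, norm_mul, Complex.norm_exp, Complex.norm_exp, ← mul_assoc]
    refine mul_le_mul_of_nonneg_right ?_ (norm_nonneg _)
    simp only [norm_neg, Complex.norm_real, Real.norm_of_nonneg ht.le, Complex.mul_re,
      Complex.neg_re, Complex.ofReal_re, Complex.neg_im, Complex.ofReal_im, mul_zero, sub_zero]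
    have e1 : Real.exp (-q.re * t) ≤ Real.exp (-(r / 2) * t) * Real.exp (-(r / 2 * t)) := by
      rw [← Real.exp_add]
      apply Real.exp_le_exp.2
      nlinarith
    have e2 : t * Real.exp (-(r / 2 * t)) ≤ 1 / (r / 2) := by
      rw [le_div_iff₀ (by positivity)]
      have e3 := Real.add_one_le_exp (r / 2 * t)
      rw [Real.exp_neg]
      have e4 := Real.exp_pos (r / 2 * t)
      rw [mul_assoc, inv_mul_eq_div, ← mul_div_assoc, div_le_one e4]
      linarith
    calc t * Real.exp (-q.re * t)
        ≤ t * (Real.exp (-(r / 2) * t) * Real.exp (-(r / 2 * t))) :=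
          mul_le_mul_of_nonneg_left e1 ht.le
      _ = (t * Real.exp (-(r / 2 * t))) * Real.exp (-(r / 2) * t) := by ring
      _ ≤ _ := mul_le_mul_of_nonneg_right e2 (Real.exp_pos _).le
  · exact (hf (r / 2) (by positivity)).norm.const_mul _
  · refine Eventually.of_forall fun t q _ => ?_
    have h1 : HasDerivAt (fun q : ℂ => -q * (t : ℂ)) (-(t : ℂ)) q := by
      simpa using ((hasDerivAt_id q).neg.mul_const (t : ℂ))
    have h2 := h1.cexp.smul_const (f t)
    rwa [mul_comm] at h2

variable [CompleteSpace F]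

/-- **Lerch's theorem**: the Laplace transform is injective. -/
theorem ae_eq_zero_of_laplace_eq_zero {f : ℝ → F}
    (hf : ∀ c : ℝ, 0 < c → IntegrableOn (fun t : ℝ => Complex.exp (-(c : ℂ) * t) • f t) (Ioi 0))
    (h : ∀ p : ℝ, 0 < p → ∫ t in Ioi (0 : ℝ), Complex.exp (-(p : ℂ) * t) • f t = 0) :
    ∀ᵐ t, t ∈ Ioi (0 : ℝ) → f t = 0 := by
  have hopen : IsOpen {p : ℂ | 0 < p.re} := isOpen_lt continuous_const Complex.continuous_re
  have hconv : Convex ℝ {p : ℂ | 0 < p.re} := convex_halfSpace_re_gt 0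
  -- The identity theorem carries the vanishing from real points accumulating at `1` to the
  -- half-plane. On the line `Re p = 1` the Laplace transform is the Fourier transform of `e ^ (-t)
  -- f`.
  have hzero : EqOn (fun p : ℂ => ∫ t in Ioi (0 : ℝ), Complex.exp (-p * t) • f t) 0
      {p : ℂ | 0 < p.re} := by
    refine ((differentiableOn_laplace hf).analyticOnNhd hopen).eqOn_of_preconnected_of_frequently_eq
      (fun z _ => analyticAt_const) hconv.isPreconnected (z₀ := 1) (by simp) ?_
    have ht : Tendsto (fun r : ℝ => (r : ℂ)) (𝓝[>] 1) (𝓝[≠] 1) := by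
      refine tendsto_nhdsWithin_iff.2 ⟨?_, ?_⟩
      · exact (Complex.continuous_ofReal.tendsto' 1 1 (by simp)).mono_left nhdsWithin_le_nhds
      · filter_upwards [self_mem_nhdsWithin] with r hr
        have hr : 1 < r := hr
        simpa using hr.ne'
    refine ht.frequently (Eventually.frequently ?_)
    filter_upwards [self_mem_nhdsWithin] with r hr
    exact h r (zero_lt_one.trans hr)
  have hg := hf 1 one_pos
  rw [← integrable_indicator_iff measurableSet_Ioi] at hg
  have := ae_eq_zero_of_fourier_eq_zero hg fun ξ => ?_
  · filter_upwards [this] with t ht ht0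
    rw [indicator_of_mem ht0] at ht
    exact (smul_eq_zero.1 ht).resolve_left (Complex.exp_ne_zero _)
  · have hz := hzero (x := 1 + 2 * Real.pi * ξ * Complex.I) (by simp)
    simp only [Pi.zero_apply] at hz
    rw [Real.fourier_real_eq_integral_exp_smul, ← hz, ← integral_indicator measurableSet_Ioi]
    congr 1
    ext t
    by_cases ht : t ∈ Ioi (0 : ℝ)
    · rw [indicator_of_mem ht, indicator_of_mem ht, smul_smul, ← Complex.exp_add]
      congr 2
      push_cast
      ring
    · rw [indicator_of_notMem ht, indicator_of_notMem ht, smul_zero]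

end Laplace

/-! ### A residue theorem on a horizontal strip -/

section Residue

variable {F : Type*} [NormedAddCommGroup F] [NormedSpace ℂ F]

/-- Equality `e ^ w = e ^ w₀` forces `w - w₀ ∈ 2πiℤ`. Hence `log p` is the only pole in the strip,
and it is simple. -/
theorem dslope_exp_ne_zero {w w₀ : ℂ} (h : |(w - w₀).im| < 2 * Real.pi) :
    dslope Complex.exp w₀ w ≠ 0 := by
  rcases eq_or_ne w w₀ with rfl | hne
  · rw [dslope_same, Complex.deriv_exp]
    exact Complex.exp_ne_zero _
  · rw [dslope_of_ne _ hne, slope_def_field]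
    refine div_ne_zero (fun h0 => hne ?_) (sub_ne_zero.2 hne)
    obtain ⟨n, hn⟩ := Complex.exp_eq_exp_iff_exists_int.1 (sub_eq_zero.1 h0)
    have him : (w - w₀).im = n * (2 * Real.pi) := by
      rw [hn]
      simp
    rw [him, abs_mul, abs_of_pos Real.two_pi_pos] at h
    have h1 : |(n : ℝ)| < 1 := by
      by_contra! h1
      nlinarith [Real.two_pi_pos]
    have h2 : n = 0 := Int.abs_lt_one_iff.1 (by exact_mod_cast h1)
    rw [hn, h2]
    simp

theorem isOpen_strip (φ : ℝ) : IsOpen {w : ℂ | |w.im| < φ} :=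
  isOpen_lt (continuous_abs.comp Complex.continuous_im) continuous_const

/-- On the strip, a function `e ^ w / (p - e ^ w) • Q w` becomes holomorphic when its pole at
`log p` is subtracted. -/
theorem exists_differentiableOn_strip_sub_pole [CompleteSpace F] {Q : ℂ → F} {φ' : ℝ} (hφ : 0 < φ')
    (hφ' : φ' < Real.pi) (hQ : DifferentiableOn ℂ Q {w | |w.im| < φ'}) {p : ℝ} (hp : 0 < p) :
    ∃ d : ℂ → F, DifferentiableOn ℂ d {w | |w.im| < φ'} ∧
      ∀ w : ℂ, |w.im| < φ' → w ≠ Real.log p →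
        d w = (Complex.exp w / (p - Complex.exp w)) • Q w + (w - Real.log p)⁻¹ • Q (Real.log p) := by
  set w₀ : ℂ := (Real.log p : ℂ) with hw₀
  have hexp : Complex.exp w₀ = p := by
    rw [hw₀, ← Complex.ofReal_exp, Real.exp_log hp]
  have hmem : {w : ℂ | |w.im| < φ'} ∈ 𝓝 w₀ :=
    (isOpen_strip φ').mem_nhds (by simpa [hw₀] using hφ)
  have hne : ∀ w ∈ {w : ℂ | |w.im| < φ'}, dslope Complex.exp w₀ w ≠ 0 := by
    intro w hw
    refine dslope_exp_ne_zero ?_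
    have hw : |w.im| < φ' := hw
    simp only [hw₀, Complex.sub_im, Complex.ofReal_im, sub_zero]
    linarith [Real.pi_pos]
  -- Away from `w₀`, `u` is the integrand times `w - w₀`; its value `-Q w₀` at `w₀` is the residue.
  -- Thus `dslope u w₀` is the integrand without its polar part.
  set u : ℂ → F := fun w => -((Complex.exp w / dslope Complex.exp w₀ w) • Q w) with hu
  have hud : DifferentiableOn ℂ u {w | |w.im| < φ'} := by
    refine ((Complex.differentiable_exp.differentiableOn.div ?_ hne).smul hQ).neg
    exact (Complex.differentiableOn_dslope hmem).2 Complex.differentiable_exp.differentiableOn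
  have hu₀ : u w₀ = - Q w₀ := by
    simp only [hu, dslope_same, Complex.deriv_exp, div_self (Complex.exp_ne_zero w₀), one_smul]
  refine ⟨dslope u w₀, (Complex.differentiableOn_dslope hmem).2 hud, fun w hw hne' => ?_⟩
  have hsub : w - w₀ ≠ 0 := sub_ne_zero.2 hne'
  have hnew := hne w hw
  rw [dslope_of_ne _ hne', slope_def_field] at hnew
  have hpe : Complex.exp w - p ≠ 0 := by
    rw [← hexp]
    exact fun h => hnew (by rw [h, zero_div])
  rw [dslope_of_ne _ hne', slope_def_module, hu₀, sub_neg_eq_add, smul_add]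
  congr 1
  simp only [hu]
  rw [dslope_of_ne _ hne', slope_def_field, hexp, smul_neg, smul_smul, ← neg_smul]
  congr 1
  have : (p : ℂ) - Complex.exp w ≠ 0 := fun h => hpe (by rw [← neg_sub, h, neg_zero])
  field_simp
  ring

/-- Neither term is integrable alone; the difference is `-2iφ / ((x - c) ^ 2 + φ ^ 2)`, a multiple
of the Poisson kernel. -/
theorem integral_strip_sub_pole (c : ℝ) {φ : ℝ} (hφ : 0 < φ) :
    Integrable (fun x : ℝ => ((x : ℂ) + φ * Complex.I - c)⁻¹ - ((x : ℂ) - φ * Complex.I - c)⁻¹) ∧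
    ∫ x : ℝ, (((x : ℂ) + φ * Complex.I - c)⁻¹ - ((x : ℂ) - φ * Complex.I - c)⁻¹) =
      -(2 * Real.pi * Complex.I) := by
  have h1 : ∀ x : ℝ, ((x : ℂ) + φ * Complex.I - c)⁻¹ - ((x : ℂ) - φ * Complex.I - c)⁻¹ =
      (-2 * Complex.I / φ) * (((1 + ((x - c) / φ) ^ 2)⁻¹ : ℝ) : ℂ) := by
    intro x
    have ha : (x : ℂ) + φ * Complex.I - c ≠ 0 := fun h => by
      have := congrArg Complex.im h
      simp at this
      exact hφ.ne' this
    have hb : (x : ℂ) - φ * Complex.I - c ≠ 0 := fun h => by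
      have := congrArg Complex.im h
      simp at this
      exact hφ.ne' this
    have hφ' : (φ : ℂ) ≠ 0 := by exact_mod_cast hφ.ne'
    have hc : (1 + (((x : ℂ) - c) / φ) ^ 2) ≠ 0 := by
      have : (0 : ℝ) < 1 + ((x - c) / φ) ^ 2 := by positivity
      exact_mod_cast this.ne'
    have key : ((x : ℂ) + φ * Complex.I - c) * ((x : ℂ) - φ * Complex.I - c) =
        φ ^ 2 * (1 + (((x : ℂ) - c) / φ) ^ 2) := by
      field_simp
      ring_nf
      simp [Complex.I_sq]
    push_cast
    rw [inv_sub_inv ha hb, key]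
    field_simp
    ring
  simp_rw [h1]
  constructor
  · refine Integrable.const_mul (Integrable.ofReal ?_) _
    exact (integrable_inv_one_add_sq.comp_div hφ.ne').comp_sub_right c
  · rw [integral_const_mul, integral_complex_ofReal,
      integral_sub_right_eq_self (fun y : ℝ => (1 + (y / φ) ^ 2)⁻¹) c,
      Measure.integral_comp_div (fun y : ℝ => (1 + y ^ 2)⁻¹), integral_univ_inv_one_add_sq,
      abs_of_pos hφ]
    have hφ' : (φ : ℂ) ≠ 0 := by exact_mod_cast hφ.ne'
    simp only [smul_eq_mul, Complex.ofReal_mul]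
    field_simp

/-- As `p` is real, `|p - e ^ w| ≥ |Im e ^ w| = |e ^ w| sin φ`. -/
theorem norm_exp_div_sub_exp_le {φ : ℝ} (hφ : 0 < Real.sin φ) {w : ℂ} (hw : |w.im| = φ) {p : ℝ} :
    ‖Complex.exp w / (p - Complex.exp w)‖ ≤ 1 / Real.sin φ := by
  rw [norm_div]
  have h1 : ‖Complex.exp w‖ * Real.sin φ ≤ ‖(p : ℂ) - Complex.exp w‖ := by
    refine le_trans (le_of_eq ?_) (Complex.abs_im_le_norm _)
    simp only [Complex.sub_im, Complex.ofReal_im, zero_sub, abs_neg, Complex.exp_im, abs_mul,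
      Complex.norm_exp, Real.abs_exp]
    congr 1
    rcases abs_eq_abs.1 (hw.trans (abs_of_nonneg (hw ▸ abs_nonneg _)).symm) with h | h
    · rw [h, abs_of_pos hφ]
    · rw [h, Real.sin_neg, abs_neg, abs_of_pos hφ]
  have h2 : 0 < ‖(p : ℂ) - Complex.exp w‖ :=
    lt_of_lt_of_le (mul_pos (norm_pos_iff.2 (Complex.exp_ne_zero w)) hφ) h1
  rw [div_le_div_iff₀ h2 hφ]
  linarith

theorem integrable_exp_neg_mul_abs {α : ℝ} (hα : 0 < α) :
    Integrable fun x : ℝ => Real.exp (-α * |x|) := by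
  rw [← integrableOn_univ, ← Iic_union_Ioi (a := (0 : ℝ)), integrableOn_union]
  constructor
  · refine (integrableOn_exp_mul_Iic hα 0).congr_fun (fun x hx => ?_) measurableSet_Iic
    have hx : x ≤ 0 := hx
    simp [abs_of_nonpos hx]
  · refine (integrableOn_exp_mul_Ioi (neg_lt_zero.2 hα) 0).congr_fun (fun x hx => ?_)
      measurableSet_Ioi
    have hx : 0 < x := hx
    simp [abs_of_pos hx]

theorem norm_exp_div_sub_exp_le_two {w : ℂ} {p : ℝ} (hp : 0 < p)
    (h : Real.exp w.re ≤ p / 2 ∨ 2 * p ≤ Real.exp w.re) :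
    ‖Complex.exp w / (p - Complex.exp w)‖ ≤ 2 := by
  rw [norm_div]
  refine div_le_of_le_mul₀ (norm_nonneg _) zero_le_two ?_
  have h1 := norm_sub_norm_le (p : ℂ) (Complex.exp w)
  have h2 := norm_sub_norm_le (Complex.exp w) (p : ℂ)
  rw [norm_sub_rev] at h2
  rw [Complex.norm_exp, Complex.norm_real, Real.norm_of_nonneg hp.le] at h1 h2
  rw [Complex.norm_exp]
  rcases h with h | h <;> linarith

theorem tendsto_integral_vertical {d : ℂ → F} {φ : ℝ} {B : ℝ → ℝ}
    (hB : Tendsto B atTop (𝓝 0)) {s : ℝ → ℝ}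
    (hd : ∀ᶠ R in atTop, ∀ y : ℝ, |y| ≤ φ → ‖d ((s R : ℂ) + y * Complex.I)‖ ≤ B R) (hφ : 0 < φ) :
    Tendsto (fun R : ℝ => ∫ y in (-φ)..φ, d ((s R : ℂ) + y * Complex.I)) atTop (𝓝 0) := by
  refine squeeze_zero_norm' (a := fun R => B R * |φ - -φ|) ?_ (by simpa using hB.mul_const _)
  filter_upwards [hd] with R hR
  refine intervalIntegral.norm_integral_le_of_norm_le_const fun y hy => hR y ?_
  rw [uIoc_of_le (by linarith)] at hy
  exact abs_le.2 ⟨hy.1.le, hy.2⟩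

/-- The residue theorem on a horizontal strip for the function `e ^ w / (p - e ^ w) • Q w`, whose
only pole is at `log p`. -/
theorem integral_strip_eq_residue [CompleteSpace F] {Q : ℂ → F} {φ φ' α M : ℝ} (hφ : 0 < φ)
    (hφφ' : φ < φ') (hφ' : φ' < Real.pi) (hα : 0 < α)
    (hQ : DifferentiableOn ℂ Q {w | |w.im| < φ'})
    (hM : ∀ w : ℂ, |w.im| ≤ φ → ‖Q w‖ ≤ M * Real.exp (-α * |w.re|)) {p : ℝ} (hp : 0 < p) :
    Integrable (fun x : ℝ => (Complex.exp (x + φ * Complex.I) /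
      (p - Complex.exp (x + φ * Complex.I))) • Q (x + φ * Complex.I)) ∧
    Integrable (fun x : ℝ => (Complex.exp (x - φ * Complex.I) /
      (p - Complex.exp (x - φ * Complex.I))) • Q (x - φ * Complex.I)) ∧
    (∫ x : ℝ, (Complex.exp (x + φ * Complex.I) /
      (p - Complex.exp (x + φ * Complex.I))) • Q (x + φ * Complex.I)) -
    (∫ x : ℝ, (Complex.exp (x - φ * Complex.I) /
      (p - Complex.exp (x - φ * Complex.I))) • Q (x - φ * Complex.I)) =
      (2 * Real.pi * Complex.I) • Q (Real.log p) := by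
  set V : ℂ → F := fun w => (Complex.exp w / (p - Complex.exp w)) • Q w with hV
  set c : ℝ := Real.log p with hc
  have hsin : 0 < Real.sin φ := Real.sin_pos_of_pos_of_lt_pi hφ (by linarith)
  have hline : ∀ s : ℝ, |s| = φ → Integrable fun x : ℝ => V (x + s * Complex.I) := by
    intro s hs
    have hmaps : ∀ x : ℝ, ((x : ℂ) + s * Complex.I).im = s := by simp
    have hcont : Continuous fun x : ℝ => V (x + s * Complex.I) := by
      refine Continuous.smul (Continuous.div (by fun_prop) (by fun_prop) fun x h0 => ?_) ?_
      · have := congrArg Complex.im h0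
        simp only [Complex.sub_im, Complex.ofReal_im, zero_sub, Complex.exp_im, hmaps,
          Complex.zero_im, neg_eq_zero, mul_eq_zero, Real.exp_ne_zero, false_or] at this
        rcases abs_eq hφ.le |>.1 hs with h | h
        · rw [h] at this; exact hsin.ne' this
        · rw [h, Real.sin_neg, neg_eq_zero] at this; exact hsin.ne' this
      · refine hQ.continuousOn.comp_continuous (by fun_prop) fun x => ?_
        rw [mem_ofPred_eq, hmaps, hs]
        exact hφφ'
    refine ((integrable_exp_neg_mul_abs hα).const_mul (1 / Real.sin φ * M)).mono'
      hcont.aestronglyMeasurable (Eventually.of_forall fun x => ?_)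
    simp only [hV, norm_smul]
    have h1 := norm_exp_div_sub_exp_le hsin (w := (x : ℂ) + s * Complex.I) (p := p)
      (by rw [hmaps, hs])
    have h2 := hM ((x : ℂ) + s * Complex.I) (by rw [hmaps, hs])
    have h3 : ((x : ℂ) + s * Complex.I).re = x := by simp
    rw [h3] at h2
    calc _ ≤ 1 / Real.sin φ * (M * Real.exp (-α * |x|)) :=
          mul_le_mul h1 h2 (norm_nonneg _) (by positivity)
      _ = _ := by ring
  have htop : Integrable fun x : ℝ => V (x + φ * Complex.I) := hline φ (abs_of_pos hφ)
  have hbot : Integrable fun x : ℝ => V (x - φ * Complex.I) := by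
    refine (hline (-φ) (by rw [abs_neg, abs_of_pos hφ])).congr (Eventually.of_forall fun x => ?_)
    simp [sub_eq_add_neg]
  refine ⟨htop, hbot, ?_⟩
  obtain ⟨d, hd, hdV⟩ := exists_differentiableOn_strip_sub_pole (hφ.trans hφφ') hφ' hQ hp
  obtain ⟨hpole, hpole'⟩ := integral_strip_sub_pole c hφ
  have hdtop : ∀ x : ℝ, d (x + φ * Complex.I) - d (x - φ * Complex.I) =
      (V (x + φ * Complex.I) - V (x - φ * Complex.I)) +
      (((x : ℂ) + φ * Complex.I - c)⁻¹ - ((x : ℂ) - φ * Complex.I - c)⁻¹) • Q c := by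
    intro x
    rw [hdV _ (by simpa [abs_of_pos hφ] using hφφ') ?_,
      hdV _ (by simpa [abs_of_pos hφ] using hφφ') ?_, sub_smul]
    · abel
    · intro h
      simpa [hφ.ne'] using congrArg Complex.im h
    · intro h
      simpa [hφ.ne'] using congrArg Complex.im h
  have hint : Integrable fun x : ℝ => d (x + φ * Complex.I) - d (x - φ * Complex.I) := by
    simp_rw [hdtop]
    exact (htop.sub hbot).add (hpole.smul_const (Q c))
  have hlim := intervalIntegral_tendsto_integral hint (a := fun R : ℝ => -R) (b := fun R => R)
    tendsto_neg_atTop_atBot tendsto_id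
  -- Cauchy's theorem on `[-R, R] × [-φ, φ]` trades the horizontal sides for the vertical ones.
  have hrect : ∀ R : ℝ, ∫ x in (-R)..R, (d (x + φ * Complex.I) - d (x - φ * Complex.I)) =
      Complex.I • (∫ y in (-φ)..φ, d ((R : ℂ) + y * Complex.I)) -
      Complex.I • (∫ y in (-φ)..φ, d (((-R : ℝ) : ℂ) + y * Complex.I)) := by
    intro R
    have hcd : ∀ s : ℝ, |s| = φ → Continuous fun x : ℝ => d (x + s * Complex.I) := fun s hs =>
      hd.continuousOn.comp_continuous (by fun_prop) fun x => by simpa [hs] using hφφ'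
    have h1 := hcd φ (abs_of_pos hφ)
    have h2 : Continuous fun x : ℝ => d (x - φ * Complex.I) := by
      simpa [sub_eq_add_neg] using hcd (-φ) (by rw [abs_neg, abs_of_pos hφ])
    have h3 := Complex.integral_boundary_rect_eq_zero_of_differentiableOn d
      ((-R : ℝ) + (-φ : ℝ) * Complex.I) (R + φ * Complex.I) (hd.mono fun w hw => ?_)
    · rw [intervalIntegral.integral_sub (h1.intervalIntegrable _ _) (h2.intervalIntegrable _ _)]
      simp only [Complex.add_re, Complex.ofReal_re, Complex.mul_re, Complex.I_re, mul_zero,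
        Complex.ofReal_im, Complex.I_im, mul_one, sub_self, add_zero, Complex.add_im,
        Complex.mul_im, zero_add] at h3
      rw [← sub_eq_zero, ← neg_eq_zero, ← h3]
      simp only [Complex.ofReal_neg, neg_mul, ← sub_eq_add_neg]
      abel
    · have := hw.2
      simp only [Complex.add_im, Complex.ofReal_im, Complex.mul_im, Complex.ofReal_re,
        Complex.I_im, mul_one, Complex.I_re, mul_zero, add_zero, zero_add, mem_preimage] at this
      rw [uIcc_of_le (by linarith)] at this
      exact (abs_le.2 this).trans_lt hφφ'
  -- On the vertical sides the original integrand is `O(e ^ (-αR))`, since `|e ^ w|` is away from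
  -- `p` by a factor `2`, and the polar part is `O(1 / R)`.
  have hside : ∀ s : ℝ → ℝ, (∀ R, |s R| = |R|) →
      (∀ᶠ R in atTop, Real.exp (s R) ≤ p / 2 ∨ 2 * p ≤ Real.exp (s R)) →
      Tendsto (fun R : ℝ => ∫ y in (-φ)..φ, d ((s R : ℂ) + y * Complex.I)) atTop (𝓝 0) := by
    intro s hs hsp
    refine tendsto_integral_vertical (B := fun R => 2 * (M * Real.exp (-α * R)) +
      (R - |c|)⁻¹ * ‖Q c‖) ?_ ?_ hφ
    · have h1 : Tendsto (fun R : ℝ => Real.exp (-α * R)) atTop (𝓝 0) :=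
        Real.tendsto_exp_atBot.comp (tendsto_id.const_mul_atTop_of_neg (neg_lt_zero.2 hα))
      have h2 : Tendsto (fun R : ℝ => (R - |c|)⁻¹) atTop (𝓝 0) :=
        by
        refine tendsto_inv_atTop_zero.comp ?_
        simpa [sub_eq_add_neg] using tendsto_atTop_add_const_right atTop (-|c|) tendsto_id
      simpa using ((h1.const_mul M).const_mul 2).add (h2.mul_const ‖Q c‖)
    · filter_upwards [hsp, eventually_gt_atTop |c|] with R hR hRc y hy
      have hR0 : |s R| = R := by rw [hs, abs_of_pos ((abs_nonneg c).trans_lt hRc)]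
      have hre : ((s R : ℂ) + y * Complex.I).re = s R := by simp
      have him : ((s R : ℂ) + y * Complex.I).im = y := by simp
      have hdist : R - |c| ≤ ‖((s R : ℂ) + y * Complex.I) - c‖ := by
        refine le_trans ?_ (Complex.abs_re_le_norm _)
        rw [Complex.sub_re, hre, Complex.ofReal_re]
        linarith [abs_sub_abs_le_abs_sub (s R) c]
      have hne : ((s R : ℂ) + y * Complex.I) ≠ c := fun h => by
        rw [h, sub_self, norm_zero] at hdist
        linarith
      rw [hdV _ (by rw [him]; exact hy.trans_lt hφφ') hne]
      refine (norm_add_le _ _).trans (add_le_add ?_ ?_)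
      · rw [norm_smul]
        have h2 := hM ((s R : ℂ) + y * Complex.I) (by rwa [him])
        rw [hre, hR0] at h2
        exact mul_le_mul (norm_exp_div_sub_exp_le_two hp (by rwa [hre])) h2 (norm_nonneg _)
          zero_le_two
      · rw [norm_smul, norm_inv]
        exact mul_le_mul_of_nonneg_right (inv_anti₀ (by linarith) hdist) (norm_nonneg _)
  have hs1 := hside (fun R => R) (fun R => rfl) <| by
    filter_upwards [Real.tendsto_exp_atTop.eventually_ge_atTop (2 * p)] with R hR using Or.inr hR
  have hs2 := hside (fun R => -R) (fun R => abs_neg R) <| by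
    filter_upwards [(Real.tendsto_exp_atBot.comp tendsto_neg_atTop_atBot).eventually_le_const
      (half_pos hp)] with R hR using Or.inl hR
  simp_rw [hrect] at hlim
  have hzero := tendsto_nhds_unique hlim
    ((hs1.const_smul Complex.I).sub (hs2.const_smul Complex.I))
  simp_rw [hdtop] at hzero
  have hadd := integral_add (htop.sub hbot) (hpole.smul_const (Q c))
  simp only [Pi.sub_apply] at hadd
  rw [hadd, integral_smul_const, hpole', integral_sub htop hbot, smul_zero, sub_zero, neg_smul,
    ← sub_eq_add_neg, sub_eq_zero] at hzero
  exact hzero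

end Residue

/-! ### Resolvent estimates in a sector -/

section Resolvent

variable {𝔸 : Type*} [NormedRing 𝔸] [NormedAlgebra ℂ 𝔸]

theorem norm_cexp_mul_ofReal (α : ℝ) (w : ℂ) :
    ‖Complex.exp (α * w)‖ = Real.exp (α * w.re) := by
  rw [Complex.norm_exp]
  simp

/-- With `r = e ^ Re w`, the square of the norm is at least `1 + 2 r cos φ + r ^ 2`. This equals
both `(r + cos φ) ^ 2 + sin² φ` and `(1 + r cos φ) ^ 2 + r ^ 2 sin² φ`. -/
theorem sin_mul_max_le_norm_one_add_cexp {φ : ℝ} (hφ₀ : 0 < φ) (hφ : φ < Real.pi) {w : ℂ}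
    (hw : |w.im| ≤ φ) :
    Real.sin φ ≤ ‖1 + Complex.exp w‖ ∧ Real.sin φ * Real.exp w.re ≤ ‖1 + Complex.exp w‖ := by
  have hsin : 0 < Real.sin φ := Real.sin_pos_of_pos_of_lt_pi hφ₀ hφ
  have hcos : Real.cos φ ≤ Real.cos w.im := by
    rw [← Real.cos_abs w.im]
    exact Real.cos_le_cos_of_nonneg_of_le_pi (abs_nonneg _) hφ.le hw
  have hsq : ‖1 + Complex.exp w‖ ^ 2 =
      1 + 2 * Real.exp w.re * Real.cos w.im + Real.exp w.re ^ 2 := by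
    rw [Complex.sq_norm, Complex.normSq_apply]
    simp only [Complex.add_re, Complex.one_re, Complex.exp_re, Complex.add_im, Complex.one_im,
      Complex.exp_im]
    nlinarith [Real.sin_sq_add_cos_sq w.im]
  have hr := Real.exp_pos w.re
  have hlow : 1 + 2 * Real.exp w.re * Real.cos φ + Real.exp w.re ^ 2 ≤
      ‖1 + Complex.exp w‖ ^ 2 := by
    rw [hsq]
    nlinarith
  have hone := Real.sin_sq_add_cos_sq φ
  constructor
  · refine (sq_le_sq₀ hsin.le (norm_nonneg _)).1 ?_
    nlinarith [sq_nonneg (Real.exp w.re + Real.cos φ)]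
  · refine (sq_le_sq₀ (by positivity) (norm_nonneg _)).1 ?_
    nlinarith [sq_nonneg (1 + Real.exp w.re * Real.cos φ)]

/-- The argument of `e ^ (αw)` is `α Im w`, without wrapping because `|α Im w| < π`; it is too small
for a spectral value. -/
theorem cexp_mul_mem_resolventSet {a : 𝔸} {α φ' : ℝ} (hα₀ : 0 < α) (hα₁ : α < 1)
    (hφ' : φ' < Real.pi) (hσ : ∀ μ ∈ spectrum ℂ a, α * φ' ≤ |Complex.arg μ|) {w : ℂ}
    (hw : |w.im| < φ') : Complex.exp (α * w) ∈ resolventSet ℂ a := by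
  by_contra h
  have h1 := hσ _ h
  have him : ((α : ℂ) * w).im = α * w.im := by simp
  have h2 : |α * w.im| < α * φ' := by
    rw [abs_mul, abs_of_pos hα₀]
    exact mul_lt_mul_of_pos_left hw hα₀
  have h3 : |α * w.im| < Real.pi := by
    have : α * φ' ≤ φ' := mul_le_of_le_one_left ((abs_nonneg _).trans_lt hw).le hα₁.le
    linarith
  rw [Complex.arg_exp, him, toIocMod_eq_self _ |>.2] at h1
  · linarith
  · constructor
    · linarith [(abs_lt.1 h3).1]
    · linarith [(abs_lt.1 h3).2]

/-- The factor `z` on the right shows that adding `a⁻¹` cancels the value of the resolvent at `0`.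
-/
theorem resolvent_add_inverse {a : 𝔸} (ha : IsUnit a) {z : ℂ} (hz : z ∈ resolventSet ℂ a) :
    resolvent a z + Ring.inverse a = z • (Ring.inverse a * resolvent a z) := by
  have h1 : (algebraMap ℂ 𝔸 z - a) * resolvent a z = 1 := by
    rw [resolvent]
    exact Ring.mul_inverse_cancel _ hz
  have h2 : Ring.inverse a * a = 1 := Ring.inverse_mul_cancel a ha
  have h3 : Ring.inverse a * ((algebraMap ℂ 𝔸 z - a) * resolvent a z) = Ring.inverse a := by
    rw [h1, mul_one]
  rw [sub_mul, mul_sub, ← mul_assoc (Ring.inverse a) a, h2, one_mul, Algebra.algebraMap_eq_smul_one,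
    smul_mul_assoc, one_mul, mul_smul_comm] at h3
  rw [← sub_eq_iff_eq_add'.1 h3]

variable [CompleteSpace 𝔸]

theorem differentiableOn_resolvent_cexp {a : 𝔸} {α φ' : ℝ} (hα₀ : 0 < α) (hα₁ : α < 1)
    (hφ' : φ' < Real.pi) (hσ : ∀ μ ∈ spectrum ℂ a, α * φ' ≤ |Complex.arg μ|) :
    DifferentiableOn ℂ (fun w : ℂ => resolvent a (Complex.exp (α * w))) {w | |w.im| < φ'} := by
  intro w hw
  have h1 := (spectrum.hasDerivAt_resolvent_const_left
    (cexp_mul_mem_resolventSet hα₀ hα₁ hφ' hσ hw)).differentiableAt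
  have h2 : DifferentiableAt ℂ (fun w : ℂ => Complex.exp (α * w)) w := by fun_prop
  exact (DifferentiableAt.comp w h1 h2).differentiableWithinAt

/-- Outside a large disc the resolvent is `O(1 / |z|)`. The rest of the closed sector is a compact
image in polar coordinates that includes the vertex `z = 0`, a regular point since `a` is a unit. -/
theorem exists_norm_resolvent_cexp_le {a : 𝔸} {α φ φ' : ℝ} (hα₀ : 0 < α) (hα₁ : α < 1)
    (hφφ' : φ < φ') (hφ' : φ' < Real.pi)
    (hσ : ∀ μ ∈ spectrum ℂ a, α * φ' ≤ |Complex.arg μ|) (ha : IsUnit a) :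
    ∃ M : ℝ, 0 ≤ M ∧ ∀ w : ℂ, |w.im| ≤ φ →
      ‖resolvent a (Complex.exp (α * w))‖ ≤ M ∧
      ‖resolvent a (Complex.exp (α * w))‖ ≤ M * Real.exp (-α * w.re) := by
  obtain ⟨C, hC⟩ := (spectrum.resolvent_isBigO_inv (𝕜 := ℂ) a).bound
  rw [Filter.eventually_iff, (Metric.hasBasis_cobounded_compl_closedBall (0 : ℂ)).mem_iff] at hC
  obtain ⟨r₀, -, hr₀⟩ := hC
  set r : ℝ := max r₀ 1 with hr
  have hr1 : 1 ≤ r := le_max_right _ _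
  have hbig : ∀ z : ℂ, r < ‖z‖ → ‖resolvent a z‖ ≤ C * ‖z‖⁻¹ := by
    intro z hz
    have : z ∈ (Metric.closedBall (0 : ℂ) r₀)ᶜ := by
      simpa using (le_max_left r₀ 1).trans_lt hz
    simpa using hr₀ this
  have hcont : ContinuousOn (fun q : ℝ × ℝ =>
      resolvent a ((q.1 : ℂ) * Complex.exp (α * (q.2 * Complex.I)))) (Icc 0 r ×ˢ Icc (-φ) φ) := by
    rintro ⟨s, θ⟩ ⟨hs, hθ⟩
    have hmem : (s : ℂ) * Complex.exp (α * (θ * Complex.I)) ∈ resolventSet ℂ a := by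
      rcases hs.1.eq_or_lt with h0 | h0
      · have : s = 0 := h0.symm
        simp only [this, Complex.ofReal_zero, zero_mul]
        exact (spectrum.zero_mem_resolventSet_of_unit ha.unit)
      · have h1 := cexp_mul_mem_resolventSet (w := ((Real.log s / α : ℝ) : ℂ) + θ * Complex.I)
          hα₀ hα₁ hφ' hσ (by simpa using (abs_le.2 hθ).trans_lt hφφ')
        convert h1 using 1
        rw [mul_add, Complex.exp_add, ← Complex.ofReal_mul, mul_div_cancel₀ _ hα₀.ne',
          ← Complex.ofReal_exp, Real.exp_log h0]
    have h1 := (spectrum.hasDerivAt_resolvent_const_left hmem).continuousAt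
    have h2 : ContinuousAt (fun q : ℝ × ℝ => (q.1 : ℂ) * Complex.exp (α * (q.2 * Complex.I)))
        (s, θ) := by fun_prop
    exact (ContinuousAt.comp (f := fun q : ℝ × ℝ =>
      (q.1 : ℂ) * Complex.exp (α * (q.2 * Complex.I))) h1 h2).continuousWithinAt
  obtain ⟨M₀, hM₀⟩ := (isCompact_Icc.prod isCompact_Icc).exists_bound_of_continuousOn hcont
  -- For `|z| ≤ r` the bound `|M₀|` is at most `|M₀| r / |z|`, and `r ≥ 1`; this makes one constant
  -- serve both inequalities.
  refine ⟨|M₀| * r + |C|, by positivity, fun w hw => ?_⟩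
  have hz : ‖Complex.exp (α * w)‖ = Real.exp (α * w.re) := norm_cexp_mul_ofReal α w
  have hpos := Real.exp_pos (α * w.re)
  rw [neg_mul, Real.exp_neg]
  rcases le_or_gt ‖Complex.exp (α * w)‖ r with h | h
  · have h1 : ‖resolvent a (Complex.exp (α * w))‖ ≤ |M₀| := by
      refine le_trans ?_ (le_abs_self M₀)
      have h2 := hM₀ (Real.exp (α * w.re), w.im) ⟨⟨hpos.le, hz ▸ h⟩, abs_le.1 hw⟩
      have h3 : Complex.exp (α * w) =
          (Real.exp (α * w.re) : ℂ) * Complex.exp (α * (w.im * Complex.I)) := by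
        rw [Complex.ofReal_exp, ← Complex.exp_add]
        congr 1
        conv_lhs => rw [← Complex.re_add_im w]
        push_cast
        ring
      rw [h3]
      exact h2
    constructor
    · nlinarith [abs_nonneg M₀, abs_nonneg C]
    · rw [hz] at h
      rw [← div_eq_mul_inv, le_div_iff₀ hpos]
      nlinarith [abs_nonneg M₀, abs_nonneg C, norm_nonneg (resolvent a (Complex.exp (α * w)))]
  · have h1 := hbig _ h
    rw [hz] at h h1
    have h3 : C * (Real.exp (α * w.re))⁻¹ ≤ |C| * (Real.exp (α * w.re))⁻¹ :=
      mul_le_mul_of_nonneg_right (le_abs_self C) (by positivity)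
    constructor
    · refine h1.trans (h3.trans ?_)
      have : (Real.exp (α * w.re))⁻¹ ≤ 1 := inv_le_one_of_one_le₀ (hr1.trans h.le)
      nlinarith [abs_nonneg M₀, abs_nonneg C]
    · refine h1.trans (h3.trans (mul_le_mul_of_nonneg_right ?_ (by positivity)))
      nlinarith [abs_nonneg M₀]

/-- A regularization of the resolvent `(e ^ (αw) - a)⁻¹` which is small at both ends of the strip. -/
noncomputable def regResolvent (a : 𝔸) (α : ℝ) (w : ℂ) : 𝔸 :=
  resolvent a (Complex.exp (α * w)) + (1 + Complex.exp w)⁻¹ • Ring.inverse a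

theorem differentiableOn_regResolvent {a : 𝔸} {α φ' : ℝ} (hα₀ : 0 < α) (hα₁ : α < 1)
    (hφ' : φ' < Real.pi) (hσ : ∀ μ ∈ spectrum ℂ a, α * φ' ≤ |Complex.arg μ|) :
    DifferentiableOn ℂ (regResolvent a α) {w | |w.im| < φ'} := by
  refine (differentiableOn_resolvent_cexp hα₀ hα₁ hφ' hσ).add (DifferentiableOn.smul_const ?_ _)
  refine DifferentiableOn.inv (by fun_prop) fun w hw h0 => ?_
  have hw : |w.im| < φ' := hw
  have hψ : (max |w.im| 1) < Real.pi := max_lt (hw.trans hφ') (by linarith [Real.pi_gt_three])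
  have h1 := (sin_mul_max_le_norm_one_add_cexp (lt_max_of_lt_right one_pos) hψ
    (le_max_left |w.im| 1)).1
  rw [h0, norm_zero] at h1
  exact absurd h1 (not_le.2 (Real.sin_pos_of_pos_of_lt_pi (lt_max_of_lt_right one_pos) hψ))

/-- For `Re w ≥ 0` both summands decay. For `Re w ≤ 0`, writing `(1 + e ^ w)⁻¹ = 1 - e ^ w / (1 + e
^ w)` pairs `a⁻¹` with the resolvent and leaves terms of size `e ^ (α Re w)` and `e ^ (Re w)`; the
first dominates as `α < 1`. -/
theorem exists_norm_regResolvent_le {a : 𝔸} {α φ φ' : ℝ} (hα₀ : 0 < α) (hα₁ : α < 1)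
    (hφ : 0 < φ) (hφφ' : φ < φ') (hφ' : φ' < Real.pi)
    (hσ : ∀ μ ∈ spectrum ℂ a, α * φ' ≤ |Complex.arg μ|) (ha : IsUnit a) :
    ∃ M : ℝ, 0 ≤ M ∧ ∀ w : ℂ, |w.im| ≤ φ →
      ‖regResolvent a α w‖ ≤ M * Real.exp (-α * |w.re|) := by
  obtain ⟨M, hM0, hM⟩ := exists_norm_resolvent_cexp_le hα₀ hα₁ hφφ' hφ' hσ ha
  have hφπ : φ < Real.pi := hφφ'.trans hφ'
  have hsin : 0 < Real.sin φ := Real.sin_pos_of_pos_of_lt_pi hφ hφπ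
  set b := Ring.inverse a with hb
  refine ⟨‖b‖ * M + M + ‖b‖ / Real.sin φ, by positivity, fun w hw => ?_⟩
  obtain ⟨h1, h2⟩ := sin_mul_max_le_norm_one_add_cexp hφ hφπ hw
  obtain ⟨h3, h4⟩ := hM w hw
  have hpos : 0 < ‖1 + Complex.exp w‖ := hsin.trans_le h1
  have hexp := Real.exp_pos (-α * |w.re|)
  rcases le_total w.re 0 with hre | hre
  · have key : regResolvent a α w = Complex.exp (α * w) • (b * resolvent a (Complex.exp (α * w))) -
        (Complex.exp w / (1 + Complex.exp w)) • b := by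
      rw [← resolvent_add_inverse ha (cexp_mul_mem_resolventSet hα₀ hα₁ hφ' hσ (hw.trans_lt hφφ')),
        regResolvent, add_sub_assoc, ← hb]
      congr 1
      have : (1 + Complex.exp w) ≠ 0 := norm_pos_iff.1 hpos
      rw [show (1 + Complex.exp w)⁻¹ = 1 - Complex.exp w / (1 + Complex.exp w) by field_simp; ring,
        sub_smul, one_smul]
    have e1 : ‖Complex.exp (α * w) • (b * resolvent a (Complex.exp (α * w)))‖ ≤
        Real.exp (-α * |w.re|) * (‖b‖ * M) := by
      rw [norm_smul, norm_cexp_mul_ofReal, abs_of_nonpos hre, neg_mul_neg]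
      refine mul_le_mul_of_nonneg_left ((norm_mul_le _ _).trans ?_) (Real.exp_pos _).le
      exact mul_le_mul_of_nonneg_left h3 (norm_nonneg _)
    have e2 : ‖(Complex.exp w / (1 + Complex.exp w)) • b‖ ≤
        Real.exp (-α * |w.re|) * (‖b‖ / Real.sin φ) := by
      rw [norm_smul, norm_div, Complex.norm_exp, abs_of_nonpos hre, neg_mul_neg]
      calc Real.exp w.re / ‖1 + Complex.exp w‖ * ‖b‖
          ≤ Real.exp (α * w.re) / Real.sin φ * ‖b‖ := by
            gcongr
            nlinarith
        _ = _ := by ring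
    rw [key]
    refine (norm_sub_le _ _).trans ((add_le_add e1 e2).trans ?_)
    nlinarith
  · rw [abs_of_nonneg hre] at hexp ⊢
    have e2 : ‖(1 + Complex.exp w)⁻¹ • b‖ ≤ Real.exp (-α * w.re) * (‖b‖ / Real.sin φ) := by
      rw [norm_smul, norm_inv]
      have : ‖1 + Complex.exp w‖⁻¹ ≤ (Real.sin φ * Real.exp (α * w.re))⁻¹ := by
        refine inv_anti₀ (by positivity) (le_trans ?_ h2)
        gcongr
        nlinarith
      calc ‖1 + Complex.exp w‖⁻¹ * ‖b‖ ≤ (Real.sin φ * Real.exp (α * w.re))⁻¹ * ‖b‖ := by gcongr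
        _ = _ := by
          rw [neg_mul, Real.exp_neg, mul_inv]
          ring
    refine (norm_add_le _ _).trans ((add_le_add h4 e2).trans ?_)
    have : 0 ≤ ‖b‖ * M * Real.exp (-α * w.re) := by positivity
    nlinarith

end Resolvent

/-! ### Laplace transforms of contour integrals -/

section Contour

variable {F : Type*} [NormedAddCommGroup F] [NormedSpace ℂ F]

/-- The exponential `e ^ (w + t e ^ w)` decays in `t` along the line `Im w = ±φ`. -/
theorem norm_cexp_add_mul_cexp {φ s : ℝ} (hs : |s| = φ) (t x : ℝ) :
    ‖Complex.exp ((x + s * Complex.I) + t * Complex.exp (x + s * Complex.I))‖ =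
      Real.exp x * Real.exp (-(-Real.cos φ * Real.exp x) * t) := by
  rw [Complex.norm_exp, ← Real.exp_add]
  congr 1
  have h : Real.cos s = Real.cos φ := by rw [← hs, Real.cos_abs]
  simp only [Complex.add_re, Complex.ofReal_re, Complex.mul_re, Complex.I_re, mul_zero,
    Complex.ofReal_im, Complex.I_im, mul_one, sub_self, add_zero, Complex.exp_re, Complex.add_im,
    Complex.mul_im, zero_add, zero_mul, sub_zero, h]
  ring

/-- The `t`-integral of `|e ^ (w + t e ^ w)|` equals `1 / |cos φ|` whatever `x` is, so integrability
of `q` is all that Tonelli needs. -/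
theorem integrable_contour {q : ℝ → F} (hq : Continuous q) (hqi : Integrable q) {φ s : ℝ}
    (hφ : Real.cos φ < 0) (hs : |s| = φ) :
    Integrable (Function.uncurry fun (t x : ℝ) =>
      Complex.exp ((x + s * Complex.I) + t * Complex.exp (x + s * Complex.I)) • q x)
      ((volume.restrict (Ioi (0 : ℝ))).prod volume) := by
  have hmeas : Continuous (Function.uncurry fun (t x : ℝ) =>
      Complex.exp ((x + s * Complex.I) + t * Complex.exp (x + s * Complex.I)) • q x) := by
    refine Continuous.smul ?_ (hq.comp continuous_snd)
    fun_prop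
  have hint : ∀ x : ℝ, IntegrableOn (fun t : ℝ =>
      Real.exp x * Real.exp (-(-Real.cos φ * Real.exp x) * t)) (Ioi 0) := fun x =>
    (integrableOn_exp_mul_Ioi
      (neg_lt_zero.2 (mul_pos (neg_pos.2 hφ) (Real.exp_pos x))) 0).const_mul _
  rw [integrable_prod_iff' hmeas.aestronglyMeasurable]
  constructor
  · refine Eventually.of_forall fun x => ?_
    refine ((hint x).mul_const ‖q x‖).mono' (hmeas.comp (by fun_prop : Continuous fun t : ℝ =>
      (t, x))).aestronglyMeasurable (Eventually.of_forall fun t => ?_)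
    simp only [Function.uncurry_apply_pair, norm_smul, norm_cexp_add_mul_cexp hs, le_refl]
  · refine (hqi.norm.const_mul (-Real.cos φ)⁻¹).congr (Eventually.of_forall fun x => ?_)
    simp only [Function.uncurry_apply_pair, norm_smul, norm_cexp_add_mul_cexp hs]
    rw [integral_mul_const, integral_const_mul, integral_exp_mul_Ioi
      (neg_lt_zero.2 (mul_pos (neg_pos.2 hφ) (Real.exp_pos x)))]
    have := Real.exp_pos x
    simp only [mul_zero, Real.exp_zero]
    field_simp

theorem integral_cexp_contour {q : ℝ → F} {φ s : ℝ} (hφ : Real.cos φ < 0) (hs : |s| = φ) {p : ℝ}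
    (hp : 0 < p) (x : ℝ) [CompleteSpace F] :
    ∫ t in Ioi (0 : ℝ), Complex.exp (-p * t) •
      Complex.exp ((x + s * Complex.I) + t * Complex.exp (x + s * Complex.I)) • q x =
    (Complex.exp (x + s * Complex.I) / (p - Complex.exp (x + s * Complex.I))) • q x := by
  set z := Complex.exp (x + s * Complex.I) with hz
  have hre : (z - p).re < 0 := by
    have h : Real.cos s = Real.cos φ := by rw [← hs, Real.cos_abs]
    simp only [hz, Complex.sub_re, Complex.exp_re, Complex.add_re, Complex.ofReal_re,
      Complex.mul_re, Complex.I_re, mul_zero, Complex.ofReal_im, Complex.I_im, mul_one, sub_self,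
      add_zero, Complex.add_im, Complex.mul_im, zero_add, h]
    have := mul_neg_of_pos_of_neg (Real.exp_pos x) hφ
    linarith
  have h1 : ∀ t : ℝ, Complex.exp (-p * t) •
      Complex.exp ((x + s * Complex.I) + t * z) • q x = Complex.exp ((z - p) * t) • (z • q x) := by
    intro t
    rw [Complex.exp_add, ← hz, smul_smul, smul_smul, mul_left_comm, ← Complex.exp_add, mul_comm]
    congr 3
    ring
  simp_rw [h1]
  rw [integral_smul_const, integral_exp_mul_complex_Ioi hre, smul_smul]
  congr 1
  have h2 : z - p ≠ 0 := fun h => by rw [h] at hre; simp at hre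
  have h3 : (p : ℂ) - z ≠ 0 := fun h => h2 (by rw [← neg_sub, h, neg_zero])
  simp only [Complex.ofReal_zero, mul_zero, Complex.exp_zero]
  field_simp
  ring

theorem laplace_contour [CompleteSpace F] {q : ℝ → F} (hq : Continuous q) (hqi : Integrable q)
    {φ s : ℝ} (hφ : Real.cos φ < 0) (hs : |s| = φ) {p : ℝ} (hp : 0 < p) :
    ∫ t in Ioi (0 : ℝ), Complex.exp (-p * t) • ∫ x : ℝ,
      Complex.exp ((x + s * Complex.I) + t * Complex.exp (x + s * Complex.I)) • q x =
    ∫ x : ℝ, (Complex.exp (x + s * Complex.I) / (p - Complex.exp (x + s * Complex.I))) • q x := by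
  simp_rw [← integral_smul, ← integral_cexp_contour (q := q) hφ hs hp]
  rw [integral_integral_swap]
  have h := integrable_contour hq hqi hφ hs
  refine Integrable.mono h ?_ ?_
  · refine Continuous.aestronglyMeasurable ?_
    refine Continuous.smul (by fun_prop) (Continuous.smul ?_ (hq.comp continuous_snd))
    fun_prop
  · have hae : ∀ᵐ z : ℝ × ℝ ∂(volume.restrict (Ioi (0 : ℝ))).prod volume, 0 < z.1 :=
      Measure.quasiMeasurePreserving_fst.ae (ae_restrict_mem measurableSet_Ioi)
    refine hae.mono fun z hz => ?_
    simp only [Function.uncurry, norm_smul (Complex.exp (-p * z.1))]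
    refine mul_le_of_le_one_left (norm_nonneg _) ?_
    rw [Complex.norm_exp, Real.exp_le_one_iff]
    simp only [Complex.mul_re, Complex.neg_re, Complex.ofReal_re, Complex.neg_im,
      Complex.ofReal_im, mul_zero, sub_zero]
    nlinarith

end Contour

/-! ### The fundamental solution as a contour integral -/

section Kernel

variable {𝔸 : Type*} [NormedRing 𝔸] [NormedAlgebra ℂ 𝔸] [CompleteSpace 𝔸]

theorem integrableOn_cexp_smul_of_integrableOn {F : Type*} [NormedAddCommGroup F] [NormedSpace ℂ F]
    {f : ℝ → F} (hf : IntegrableOn f (Ioi 0)) {p : ℝ} (hp : 0 ≤ p) :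
    IntegrableOn (fun t : ℝ => Complex.exp (-p * t) • f t) (Ioi 0) := by
  refine Integrable.mono hf (AEStronglyMeasurable.smul (by fun_prop) hf.aestronglyMeasurable) ?_
  refine (ae_restrict_mem measurableSet_Ioi).mono fun t ht => ?_
  have ht : 0 < t := ht
  rw [norm_smul]
  refine mul_le_of_le_one_left (norm_nonneg _) ?_
  rw [Complex.norm_exp, Real.exp_le_one_iff]
  simp only [Complex.mul_re, Complex.neg_re, Complex.ofReal_re, Complex.neg_im,
    Complex.ofReal_im, mul_zero, sub_zero]
  nlinarith

/-- There is an integrable function (namely `t ^ (α - 1) * E_{α,α}(t ^ α a)`) with Laplace transform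
`(p ^ α - a)⁻¹`. -/
theorem exists_integrableOn_laplace_eq_resolvent {a : 𝔸} {α φ' : ℝ} (hα₀ : 0 < α) (hα₁ : α < 1)
    (hφ : Real.pi / 2 < φ') (hφ' : φ' < Real.pi)
    (hσ : ∀ μ ∈ spectrum ℂ a, α * φ' ≤ |Complex.arg μ|) (ha : IsUnit a) :
    ∃ S : ℝ → 𝔸, IntegrableOn S (Ioi 0) ∧ ∀ p : ℝ, 0 < p →
      ∫ t in Ioi (0 : ℝ), Complex.exp (-p * t) • S t = resolvent a ((p ^ α : ℝ) : ℂ) := by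
  -- Beyond `π / 2` the factor `e ^ (t e ^ w)` decays; below `φ'` the resolvent estimates hold.
  obtain ⟨φ, hφ₁, hφ₂⟩ := exists_between hφ
  have hφ₀ : 0 < φ := by linarith [Real.pi_pos]
  have hcos : Real.cos φ < 0 := Real.cos_neg_of_pi_div_two_lt_of_lt hφ₁ (by linarith)
  set Q := regResolvent a α with hQ
  obtain ⟨M, hM0, hM⟩ := exists_norm_regResolvent_le hα₀ hα₁ hφ₀ hφ₂ hφ' hσ ha
  have hd := differentiableOn_regResolvent hα₀ hα₁ hφ' hσ
  have hqc : ∀ s : ℝ, |s| = φ → Continuous fun x : ℝ => Q (x + s * Complex.I) := fun s hs =>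
    hd.continuousOn.comp_continuous (by fun_prop) fun x => by simpa [hs] using hφ₂
  have hqi : ∀ s : ℝ, |s| = φ → Integrable fun x : ℝ => Q (x + s * Complex.I) := fun s hs =>
    ((integrable_exp_neg_mul_abs hα₀).const_mul M).mono' (hqc s hs).aestronglyMeasurable
      (Eventually.of_forall fun x => by simpa using hM (x + s * Complex.I) (by simp [hs]))
  have hs₁ : |φ| = φ := abs_of_pos hφ₀
  have hs₂ : |(-φ)| = φ := by rw [abs_neg, hs₁]
  set G : ℝ → ℝ → 𝔸 := fun s t => ∫ x : ℝ,
    Complex.exp ((x + s * Complex.I) + t * Complex.exp (x + s * Complex.I)) •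
      Q (x + s * Complex.I) with hG
  have hGi : ∀ s : ℝ, |s| = φ → IntegrableOn (G s) (Ioi 0) := fun s hs =>
    (integrable_contour (hqc s hs) (hqi s hs) hcos hs).integral_prod_left
  have hexp : IntegrableOn (fun t : ℝ => Complex.exp (-1 * (t : ℂ))) (Ioi 0) :=
    integrableOn_exp_mul_complex_Ioi (by simp) 0
  have hexpb : IntegrableOn (fun t : ℝ => Complex.exp (-1 * (t : ℂ)) • Ring.inverse a) (Ioi 0) :=
    hexp.smul_const _
  have hdiff : IntegrableOn (fun t : ℝ => (2 * Real.pi * Complex.I : ℂ)⁻¹ • (G φ t - G (-φ) t))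
      (Ioi 0) := Integrable.smul (2 * Real.pi * Complex.I : ℂ)⁻¹ ((hGi φ hs₁).sub (hGi (-φ) hs₂))
  -- The contour integral represents the regularized resolvent. At `w = log p` the regularizing term
  -- is `(1 + p)⁻¹ a⁻¹`, the transform of `e ^ (-t) a⁻¹`, which is subtracted here.
  refine ⟨fun t => (2 * Real.pi * Complex.I : ℂ)⁻¹ • (G φ t - G (-φ) t) -
    Complex.exp (-1 * (t : ℂ)) • Ring.inverse a, hdiff.sub hexpb, fun p hp => ?_⟩
  have hI := integrableOn_cexp_smul_of_integrableOn hdiff hp.le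
  have hI' := integrableOn_cexp_smul_of_integrableOn hexpb hp.le
  have hI₁ := integrableOn_cexp_smul_of_integrableOn (hGi φ hs₁) hp.le
  have hI₂ := integrableOn_cexp_smul_of_integrableOn (hGi (-φ) hs₂) hp.le
  simp_rw [smul_sub (Complex.exp (-p * _))]
  rw [integral_sub hI hI']
  have h1 : ∫ t in Ioi (0 : ℝ), Complex.exp (-p * t) •
      (2 * Real.pi * Complex.I : ℂ)⁻¹ • (G φ t - G (-φ) t) = Q (Real.log p) := by
    simp_rw [smul_comm (Complex.exp _), smul_sub (Complex.exp (-p * _))]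
    rw [integral_smul, integral_sub hI₁ hI₂, laplace_contour (hqc φ hs₁) (hqi φ hs₁) hcos hs₁ hp,
      laplace_contour (hqc (-φ) hs₂) (hqi (-φ) hs₂) hcos hs₂ hp]
    have := (integral_strip_eq_residue hφ₀ hφ₂ hφ' hα₀ hd hM hp).2.2
    simp only [Complex.ofReal_neg, neg_mul, ← sub_eq_add_neg]
    rw [this, smul_smul, inv_mul_cancel₀, one_smul]
    simp [Real.pi_ne_zero]
  have h2 : ∫ t in Ioi (0 : ℝ), Complex.exp (-p * t) • Complex.exp (-1 * (t : ℂ)) •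
      Ring.inverse a = (1 + (p : ℂ))⁻¹ • Ring.inverse a := by
    have : ∀ t : ℝ, Complex.exp (-p * t) • Complex.exp (-1 * (t : ℂ)) • Ring.inverse a =
        Complex.exp ((-p - 1) * t) • Ring.inverse a := by
      intro t
      rw [smul_smul, ← Complex.exp_add]
      congr 2
      ring
    simp_rw [this]
    rw [integral_smul_const, integral_exp_mul_complex_Ioi (by simp; linarith)]
    congr 1
    have h3 : (1 + (p : ℂ)) ≠ 0 := by
      have : (0 : ℝ) < 1 + p := by linarith
      exact_mod_cast this.ne'
    rw [show (-(p : ℂ) - 1) = -(1 + p) by ring, Complex.ofReal_zero, mul_zero, Complex.exp_zero,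
      neg_div_neg_eq, one_div]
  have h3 : Complex.exp (Real.log p : ℂ) = p := by
    rw [← Complex.ofReal_exp, Real.exp_log hp]
  have h4 : Complex.exp (α * (Real.log p : ℂ)) = ((p ^ α : ℝ) : ℂ) := by
    rw [← Complex.ofReal_mul, ← Complex.ofReal_exp, Real.rpow_def_of_pos hp, mul_comm]
  rw [h1, h2, hQ, regResolvent, h3, h4, add_sub_cancel_right]

end Kernel

/-! ### Laplace transforms of convolutions and of the Abel kernel -/

section LaplaceConvolution

variable {F : Type*} [NormedAddCommGroup F] [NormedSpace ℂ F]

/-- Splitting `e ^ (-pt) = e ^ (-ps) e ^ (-p(t - s))` exhibits a convolution of two integrable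
functions, the form needed for `integral_posConvolution`. -/
theorem cexp_smul_integral_convolution (κ : ℝ → ℝ) (S : ℝ → F) (p t : ℝ) :
    Complex.exp (-p * t) • ∫ s in 0..t, κ s • S (t - s) =
      ∫ s in 0..t, ContinuousLinearMap.lsmul ℝ ℝ (Real.exp (-p * s) * κ s)
        (Complex.exp (-p * ((t - s : ℝ) : ℂ)) • S (t - s)) := by
  rw [← intervalIntegral.integral_smul]
  congr 1
  ext s
  rw [ContinuousLinearMap.lsmul_apply, ← Complex.coe_smul, ← Complex.coe_smul, smul_smul, smul_smul]
  congr 1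
  push_cast
  rw [mul_right_comm, ← Complex.exp_add]
  congr 2
  ring

theorem integrableOn_laplace_convolution {κ : ℝ → ℝ} {S : ℝ → F} {p : ℝ}
    (hκ : IntegrableOn (fun t => Real.exp (-p * t) * κ t) (Ioi 0))
    (hS : IntegrableOn (fun t : ℝ => Complex.exp (-p * t) • S t) (Ioi 0)) :
    IntegrableOn (fun t : ℝ => Complex.exp (-p * t) • ∫ s in 0..t, κ s • S (t - s)) (Ioi 0) := by
  simp_rw [cexp_smul_integral_convolution]
  rw [← integrable_indicator_iff measurableSet_Ioi]
  exact integrable_posConvolution hκ hS (ContinuousLinearMap.lsmul ℝ ℝ)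

theorem laplace_convolution [CompleteSpace F] {κ : ℝ → ℝ} {S : ℝ → F} {p : ℝ}
    (hκ : IntegrableOn (fun t => Real.exp (-p * t) * κ t) (Ioi 0))
    (hS : IntegrableOn (fun t : ℝ => Complex.exp (-p * t) • S t) (Ioi 0)) :
    ∫ t in Ioi (0 : ℝ), Complex.exp (-p * t) • ∫ s in 0..t, κ s • S (t - s) =
      (∫ t in Ioi (0 : ℝ), Real.exp (-p * t) * κ t) •
        ∫ t in Ioi (0 : ℝ), Complex.exp (-p * t) • S t := by
  simp_rw [cexp_smul_integral_convolution]
  exact integral_posConvolution hκ hS (ContinuousLinearMap.lsmul ℝ ℝ)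

end LaplaceConvolution

/-- The kernel of the fractional integral of order `1 - α`. -/
noncomputable def abelKernel (α s : ℝ) : ℝ := s ^ (-α) / Real.Gamma (1 - α)

theorem integrableOn_laplace_abelKernel {α : ℝ} (hα₁ : α < 1) {p : ℝ} (hp : 0 < p) :
    IntegrableOn (fun t => Real.exp (-p * t) * abelKernel α t) (Ioi 0) := by
  have h := integrableOn_rpow_mul_exp_neg_mul_rpow (s := -α) (p := 1) (by linarith) one_pos hp
  refine IntegrableOn.congr_fun (h.div_const (Real.Gamma (1 - α))) (fun t _ => ?_) measurableSet_Ioi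
  simp only [Real.rpow_one, abelKernel]
  ring

theorem laplace_abelKernel {α : ℝ} (hα₁ : α < 1) {p : ℝ} (hp : 0 < p) :
    ∫ t in Ioi (0 : ℝ), Real.exp (-p * t) * abelKernel α t = p⁻¹ * p ^ α := by
  have h := Real.integral_rpow_mul_exp_neg_mul_Ioi (a := 1 - α) (r := p) (by linarith) hp
  have hΓ : Real.Gamma (1 - α) ≠ 0 := (Real.Gamma_pos_of_pos (by linarith)).ne'
  have h1 : ∀ t : ℝ, Real.exp (-p * t) * abelKernel α t =
      (t ^ (1 - α - 1) * Real.exp (-(p * t))) / Real.Gamma (1 - α) := by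
    intro t
    rw [abelKernel, show 1 - α - 1 = -α by ring, neg_mul]
    ring
  simp_rw [h1]
  rw [integral_div, h, mul_div_cancel_right₀ _ hΓ, one_div, Real.inv_rpow hp.le, ← Real.rpow_neg hp.le,
    neg_sub, Real.rpow_sub hp, Real.rpow_one]
  ring

/-! ### Total integral and convolution identities of the fundamental solution -/

section Kernel

variable {𝔸 : Type*} [NormedRing 𝔸] [NormedAlgebra ℂ 𝔸] [CompleteSpace 𝔸]

/-- If the spectrum of `a` lies outside a closed sector of half-angle larger than `απ/2`, then the
fundamental solution `S` of the fractional equation is integrable on the half-line. -/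
theorem exists_integrableOn_resolvent_kernel {a : 𝔸} {α φ' : ℝ} (hα₀ : 0 < α) (hα₁ : α < 1)
    (hφ : Real.pi / 2 < φ') (hφ' : φ' < Real.pi)
    (hσ : ∀ μ ∈ spectrum ℂ a, α * φ' ≤ |Complex.arg μ|) (ha : IsUnit a) :
    ∃ S : ℝ → 𝔸, IntegrableOn S (Ioi 0) ∧ (∫ t in Ioi (0 : ℝ), S t) * a = -1 ∧
      (∀ᵐ t, t ∈ Ioi (0 : ℝ) →
        ∫ s in 0..t, abelKernel α s • S (t - s) = 1 + a * ∫ s in 0..t, S s) ∧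
      (∀ᵐ t, t ∈ Ioi (0 : ℝ) →
        ∫ s in 0..t, abelKernel α s • S (t - s) = 1 + (∫ s in 0..t, S s) * a) := by
  obtain ⟨S, hS, hL⟩ := exists_integrableOn_laplace_eq_resolvent hα₀ hα₁ hφ hφ' hσ ha
  have hres : ∀ p : ℝ, 0 < p → ((p ^ α : ℝ) : ℂ) ∈ resolventSet ℂ a := by
    intro p hp
    have h1 := cexp_mul_mem_resolventSet (w := (Real.log p : ℂ)) hα₀ hα₁ hφ' hσ
      (by simpa using by linarith [Real.pi_pos])
    rwa [← Complex.ofReal_mul, ← Complex.ofReal_exp, mul_comm, ← Real.rpow_def_of_pos hp] at h1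
  have hone : ∀ p : ℝ, 0 < p → IntegrableOn (fun t : ℝ => Real.exp (-p * t) * 1) (Ioi 0) :=
    fun p hp => by simpa using integrableOn_exp_mul_Ioi (neg_lt_zero.2 hp) 0
  have hSp : ∀ p : ℝ, 0 < p → IntegrableOn (fun t : ℝ => Complex.exp (-p * t) • S t) (Ioi 0) :=
    fun p hp => integrableOn_cexp_smul_of_integrableOn hS hp.le
  have hI1 : ∀ p : ℝ, 0 < p → IntegrableOn
      (fun t : ℝ => Complex.exp (-p * t) • ∫ s in 0..t, abelKernel α s • S (t - s)) (Ioi 0) :=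
    fun p hp => integrableOn_laplace_convolution (integrableOn_laplace_abelKernel hα₁ hp) (hSp p hp)
  have hI2 : ∀ p : ℝ, 0 < p → IntegrableOn
      (fun t : ℝ => Complex.exp (-p * t) • (1 : 𝔸)) (Ioi 0) := fun p hp =>
    (integrableOn_exp_mul_complex_Ioi (by simpa using hp) 0).smul_const _
  have hconv : ∀ t : ℝ, ∫ s in 0..t, (1 : ℝ) • S (t - s) = ∫ s in 0..t, S s := by
    intro t
    simp
  have hI3 : ∀ p : ℝ, 0 < p → IntegrableOn
      (fun t : ℝ => Complex.exp (-p * t) • ∫ s in 0..t, S s) (Ioi 0) := by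
    intro p hp
    simpa only [hconv] using integrableOn_laplace_convolution (hone p hp) (hSp p hp)
  have hL1 : ∀ p : ℝ, 0 < p → ∫ t in Ioi (0 : ℝ), Complex.exp (-p * t) • ∫ s in 0..t,
      abelKernel α s • S (t - s) = (p⁻¹ * p ^ α) • resolvent a ((p ^ α : ℝ) : ℂ) := by
    intro p hp
    rw [laplace_convolution (integrableOn_laplace_abelKernel hα₁ hp) (hSp p hp),
      laplace_abelKernel hα₁ hp, hL p hp]
  have hL2 : ∀ p : ℝ, 0 < p → ∫ t in Ioi (0 : ℝ), Complex.exp (-p * t) • (1 : 𝔸) =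
      p⁻¹ • (1 : 𝔸) := by
    intro p hp
    rw [integral_smul_const, integral_exp_mul_complex_Ioi (by simpa using hp),
      ← Complex.coe_smul]
    simp
  have hL3 : ∀ p : ℝ, 0 < p → ∫ t in Ioi (0 : ℝ), Complex.exp (-p * t) • ∫ s in 0..t, S s =
      p⁻¹ • resolvent a ((p ^ α : ℝ) : ℂ) := by
    intro p hp
    have h := laplace_convolution (hone p hp) (hSp p hp)
    simp only [hconv] at h
    rw [h, hL p hp]
    congr 1
    simp only [mul_one]
    rw [integral_exp_mul_Ioi (neg_lt_zero.2 hp)]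
    simp
  refine ⟨S, hS, ?_, ?_, ?_⟩
  -- As `p → 0+` the transform of `S` tends to `∫ S` by dominated convergence, and the resolvent at
  -- `p ^ α` tends to the one at `0`, namely `-a⁻¹`.
  · have h1 : Tendsto (fun p : ℝ => ∫ t in Ioi (0 : ℝ), Complex.exp (-p * t) • S t) (𝓝[>] 0)
        (𝓝 (∫ t in Ioi (0 : ℝ), S t)) := by
      refine tendsto_integral_filter_of_dominated_convergence (fun t => ‖S t‖) ?_ ?_ hS.norm ?_
      · filter_upwards [self_mem_nhdsWithin] with p hp using (hSp p hp).aestronglyMeasurable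
      · filter_upwards [self_mem_nhdsWithin] with p hp
        refine (ae_restrict_mem measurableSet_Ioi).mono fun t ht => ?_
        have ht : 0 < t := ht
        have hp : 0 < p := hp
        rw [norm_smul]
        refine mul_le_of_le_one_left (norm_nonneg _) ?_
        rw [Complex.norm_exp, Real.exp_le_one_iff]
        simp only [Complex.mul_re, Complex.neg_re, Complex.ofReal_re, Complex.neg_im,
          Complex.ofReal_im, mul_zero, sub_zero]
        nlinarith
      · refine Eventually.of_forall fun t => ?_
        have : Continuous fun p : ℝ => Complex.exp (-p * t) • S t := by fun_prop
        exact (this.tendsto' 0 (S t) (by simp)).mono_left nhdsWithin_le_nhds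
    have h2 : Tendsto (fun p : ℝ => resolvent a ((p ^ α : ℝ) : ℂ)) (𝓝[>] 0)
        (𝓝 (resolvent a (0 : ℂ))) := by
      have h3 := (spectrum.hasDerivAt_resolvent_const_left
        (spectrum.zero_mem_resolventSet_of_unit (R := ℂ) ha.unit)).continuousAt
      have h4 : Tendsto (fun p : ℝ => ((p ^ α : ℝ) : ℂ)) (𝓝[>] 0) (𝓝 0) := by
        have : Continuous fun p : ℝ => ((p ^ α : ℝ) : ℂ) :=
          Complex.continuous_ofReal.comp (Real.continuous_rpow_const hα₀.le)
        refine (this.tendsto' 0 0 ?_).mono_left nhdsWithin_le_nhds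
        simp [Real.zero_rpow hα₀.ne']
      exact h3.tendsto.comp h4
    have h5 : ∫ t in Ioi (0 : ℝ), S t = resolvent a (0 : ℂ) := by
      refine tendsto_nhds_unique h1 (h2.congr' ?_)
      filter_upwards [self_mem_nhdsWithin] with p hp using (hL p hp).symm
    rw [h5, resolvent, map_zero, zero_sub, ← neg_inj, ← mul_neg, neg_neg,
      Ring.inverse_mul_cancel _ ha.neg]
  -- With `R = (p ^ α - a)⁻¹` the transforms agree because `p ^ α R = 1 + a R`; the second identity
  -- uses `1 + R a` in the same way.
  · have key := ae_eq_zero_of_laplace_eq_zero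
      (f := fun t => (∫ s in 0..t, abelKernel α s • S (t - s)) - 1 - a * ∫ s in 0..t, S s) ?_ ?_
    · filter_upwards [key] with t ht ht0
      rw [← sub_eq_zero, ← sub_sub, ht ht0]
    · intro p hp
      simp only [smul_sub, ← mul_smul_comm]
      exact ((hI1 p hp).sub (hI2 p hp)).sub ((hI3 p hp).const_mul a)
    · intro p hp
      simp only [smul_sub, ← mul_smul_comm]
      have hadd := integral_sub ((hI1 p hp).sub (hI2 p hp)) ((hI3 p hp).const_mul a)
      simp only [Pi.sub_apply] at hadd
      rw [hadd,
        integral_sub (hI1 p hp) (hI2 p hp), integral_const_mul_of_integrable (hI3 p hp),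
        hL1 p hp, hL2 p hp, hL3 p hp]
      have h1 : (algebraMap ℂ 𝔸 ((p ^ α : ℝ) : ℂ) - a) * resolvent a ((p ^ α : ℝ) : ℂ) = 1 :=
        Ring.mul_inverse_cancel _ (hres p hp)
      rw [sub_mul, Algebra.algebraMap_eq_smul_one, smul_mul_assoc, one_mul, Complex.coe_smul,
        sub_eq_iff_eq_add] at h1
      rw [mul_smul, h1, smul_add, mul_smul_comm]
      abel
  · have key := ae_eq_zero_of_laplace_eq_zero
      (f := fun t => (∫ s in 0..t, abelKernel α s • S (t - s)) - 1 - (∫ s in 0..t, S s) * a) ?_ ?_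
    · filter_upwards [key] with t ht ht0
      rw [← sub_eq_zero, ← sub_sub, ht ht0]
    · intro p hp
      simp only [smul_sub, ← smul_mul_assoc]
      exact ((hI1 p hp).sub (hI2 p hp)).sub ((hI3 p hp).mul_const a)
    · intro p hp
      simp only [smul_sub, ← smul_mul_assoc]
      have hadd := integral_sub ((hI1 p hp).sub (hI2 p hp)) ((hI3 p hp).mul_const a)
      simp only [Pi.sub_apply] at hadd
      rw [hadd,
        integral_sub (hI1 p hp) (hI2 p hp), integral_mul_const_of_integrable (hI3 p hp),
        hL1 p hp, hL2 p hp, hL3 p hp]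
      have h1 : resolvent a ((p ^ α : ℝ) : ℂ) * (algebraMap ℂ 𝔸 ((p ^ α : ℝ) : ℂ) - a) = 1 :=
        Ring.inverse_mul_cancel _ (hres p hp)
      rw [mul_sub, Algebra.algebraMap_eq_smul_one, mul_smul_comm, mul_one, Complex.coe_smul,
        sub_eq_iff_eq_add] at h1
      rw [mul_smul, h1, smul_add, smul_mul_assoc]
      abel

end Kernel

/-! ### Cutting convolutions off to bounded intervals -/

section Truncation

variable {X Y Z : Type*} [NormedAddCommGroup X] [NormedSpace ℝ X] [NormedAddCommGroup Y]
  [NormedSpace ℝ Y] [NormedAddCommGroup Z] [NormedSpace ℝ Z]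

theorem integrable_truncation {X : Type*} [NormedAddCommGroup X] {f : ℝ → X} {T : ℝ}
    (hf : IntegrableOn f (Icc 0 T)) :
    Integrable ((Icc 0 T).indicator f) :=
  hf.integrable_indicator measurableSet_Icc

theorem integrableOn_Icc_of_integrableOn_Ioi {X : Type*} [NormedAddCommGroup X]
    {f : ℝ → X} (hf : IntegrableOn f (Ioi 0))
    (T : ℝ) :
    IntegrableOn f (Icc 0 T) :=
  ((integrableOn_Ici_iff_integrableOn_Ioi).2 hf).mono_set Icc_subset_Ici_self

/-- By causality, up to time `T` only the data on `[0, T]` enter. The whole-line convolution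
theorems thus become available for kernels, such as `abelKernel`, that are integrable only on
bounded intervals. -/
theorem truncated_convolution_integrand (f : ℝ → X) (g : ℝ → Y) (L : X →L[ℝ] Y →L[ℝ] Z)
    {T x : ℝ} (hx : x ≤ T) (s : ℝ) :
    L ((Icc 0 T).indicator f s) ((Icc 0 T).indicator g (x - s)) =
      (Icc 0 x).indicator (fun s => L (f s) (g (x - s))) s := by
  by_cases h : s ∈ Icc 0 x
  · rw [indicator_of_mem h, indicator_of_mem (show s ∈ Icc 0 T from ⟨h.1, h.2.trans hx⟩),
      indicator_of_mem (show x - s ∈ Icc 0 T from ⟨by linarith [h.2], by linarith [h.1]⟩)]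
  · rw [indicator_of_notMem h]
    by_cases h1 : s ∈ Icc 0 T
    · have h2 : x - s ∉ Icc 0 T := fun h2 => h ⟨h1.1, by linarith [h2.1]⟩
      rw [indicator_of_notMem h2, map_zero]
    · rw [indicator_of_notMem h1, map_zero, zero_apply]

theorem truncated_convolution (f : ℝ → X) (g : ℝ → Y) (L : X →L[ℝ] Y →L[ℝ] Z) {T x : ℝ}
    (hx₀ : 0 ≤ x) (hx : x ≤ T) :
    convolution ((Icc 0 T).indicator f) ((Icc 0 T).indicator g) L volume x =
      ∫ s in 0..x, L (f s) (g (x - s)) := by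
  rw [convolution_def]
  simp_rw [truncated_convolution_integrand f g L hx]
  rw [integral_indicator measurableSet_Icc, integral_Icc_eq_integral_Ioc,
    intervalIntegral.integral_of_le hx₀]

theorem ae_intervalIntegrable_convolution {f : ℝ → X} {g : ℝ → Y} (L : X →L[ℝ] Y →L[ℝ] Z)
    (hf : ∀ T, IntegrableOn f (Icc 0 T)) (hg : ∀ T, IntegrableOn g (Icc 0 T)) :
    ∀ᵐ t, t ∈ Ioi (0 : ℝ) → IntervalIntegrable (fun s => L (f s) (g (t - s))) volume 0 t := by
  have h : ∀ᵐ t : ℝ, ∀ n : ℕ, ConvolutionExistsAt ((Icc (0 : ℝ) n).indicator f)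
      ((Icc (0 : ℝ) n).indicator g) t L volume := ae_all_iff.2 fun n =>
    ((hf n).integrable_indicator measurableSet_Icc).ae_convolution_exists L
      ((hg n).integrable_indicator measurableSet_Icc)
  filter_upwards [h] with t ht ht₀
  obtain ⟨n, hn⟩ := exists_nat_ge t
  have h1 := ht n
  rw [ConvolutionExistsAt] at h1
  simp_rw [truncated_convolution_integrand f g L hn] at h1
  rw [integrable_indicator_iff measurableSet_Icc, integrableOn_Icc_iff_integrableOn_Ioc] at h1
  exact (intervalIntegrable_iff_integrableOn_Ioc_of_le (le_of_lt ht₀)).2 h1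

end Truncation

/-! ### Half-line convolution with an operator kernel -/

section OperatorConvolution

variable {E : Type*} [NormedAddCommGroup E] [NormedSpace ℝ E]

/-- The convolution on the half-line of an operator-valued and a vector-valued function. -/
noncomputable def opConv (K : ℝ → E →L[ℝ] E) (u : ℝ → E) (t : ℝ) : E :=
  ∫ s in 0..t, K s (u (t - s))

/-- The convolution on the half-line of two operator-valued functions. -/
noncomputable def opMul (K S : ℝ → E →L[ℝ] E) (t : ℝ) : E →L[ℝ] E :=
  ∫ s in 0..t, K s * S (t - s)

theorem opConv_congr {K : ℝ → E →L[ℝ] E} {u v : ℝ → E} {t : ℝ} (ht : 0 ≤ t)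
    (h : ∀ s ∈ Icc 0 t, u s = v s) : opConv K u t = opConv K v t := by
  refine intervalIntegral.integral_congr fun s hs => ?_
  rw [uIcc_of_le ht] at hs
  simp only [h (t - s) ⟨by linarith [hs.2], by linarith [hs.1]⟩]

theorem opConv_congr_left {K L : ℝ → E →L[ℝ] E} {u : ℝ → E} {t : ℝ} (ht : 0 ≤ t)
    (h : ∀ᵐ s, s ∈ Ioi (0 : ℝ) → K s = L s) : opConv K u t = opConv L u t := by
  refine intervalIntegral.integral_congr_ae ?_
  filter_upwards [h] with s hs hst
  rw [uIoc_of_le ht] at hst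
  rw [hs hst.1]

/-- Associativity of whole-line convolution, applied to cut-off functions. Boundedness of the
cut-off `u` makes the integrals exist at every `t` and not just almost everywhere. -/
theorem opConv_opConv [CompleteSpace E] {K S : ℝ → E →L[ℝ] E} {u : ℝ → E} {T t : ℝ}
    (hK : IntegrableOn K (Icc 0 T)) (hS : IntegrableOn S (Icc 0 T)) (hu : ContinuousOn u (Icc 0 T))
    (ht : t ∈ Icc 0 T) : opConv K (opConv S u) t = opConv (opMul K S) u t := by
  set K' := (Icc 0 T).indicator K with hK'
  set S' := (Icc 0 T).indicator S with hS'
  set u' := (Icc 0 T).indicator u with hu'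
  have hKi : Integrable K' := integrable_truncation hK
  have hSi : Integrable S' := integrable_truncation hS
  have hui : Integrable u' :=
    (hu.integrableOn_compact isCompact_Icc).integrable_indicator measurableSet_Icc
  obtain ⟨C, hC⟩ := isCompact_Icc.exists_bound_of_continuousOn hu
  have hub : ∀ s, ‖u' s‖ ≤ |C| := by
    intro s
    by_cases hs : s ∈ Icc 0 T
    · rw [hu', indicator_of_mem hs]
      exact (hC s hs).trans (le_abs_self C)
    · rw [hu', indicator_of_notMem hs, norm_zero]
      exact abs_nonneg C
  set L₁ := ContinuousLinearMap.mul ℝ (E →L[ℝ] E)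
  set L₂ := ContinuousLinearMap.id ℝ (E →L[ℝ] E)
  have hgk : ∀ x, ConvolutionExistsAt (fun x => ‖S' x‖) (fun x => ‖u' x‖) x
      (ContinuousLinearMap.mul ℝ ℝ) volume := by
    intro x
    refine (hSi.norm.mul_const |C|).mono'
      (hSi.norm.aestronglyMeasurable.convolution_integrand_snd (L := ContinuousLinearMap.mul ℝ ℝ)
        hui.norm.aestronglyMeasurable x) (Eventually.of_forall fun s => ?_)
    simp only [ContinuousLinearMap.mul_apply', norm_mul, norm_norm]
    exact mul_le_mul_of_nonneg_left (hub _) (norm_nonneg _)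
  have hgkb : ∀ x, ‖convolution (fun x => ‖S' x‖) (fun x => ‖u' x‖)
      (ContinuousLinearMap.mul ℝ ℝ) volume x‖ ≤ ∫ s, ‖S' s‖ * |C| := by
    intro x
    refine norm_integral_le_of_norm_le (hSi.norm.mul_const |C|) (Eventually.of_forall fun s => ?_)
    simp only [ContinuousLinearMap.mul_apply', norm_mul, norm_norm]
    exact mul_le_mul_of_nonneg_left (hub _) (norm_nonneg _)
  have hgkm : AEStronglyMeasurable (convolution (fun x => ‖S' x‖) (fun x => ‖u' x‖)
      (ContinuousLinearMap.mul ℝ ℝ) volume) volume :=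
    (hSi.norm.integrable_convolution (ContinuousLinearMap.mul ℝ ℝ) hui.norm).aestronglyMeasurable
  have hfgk : ConvolutionExistsAt (fun x => ‖K' x‖) (convolution (fun x => ‖S' x‖)
      (fun x => ‖u' x‖) (ContinuousLinearMap.mul ℝ ℝ) volume) t
      (ContinuousLinearMap.mul ℝ ℝ) volume := by
    refine (hKi.norm.mul_const (∫ s, ‖S' s‖ * |C|)).mono'
      (hKi.norm.aestronglyMeasurable.convolution_integrand_snd (L := ContinuousLinearMap.mul ℝ ℝ)
        hgkm t) (Eventually.of_forall fun s => ?_)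
    simp only [ContinuousLinearMap.mul_apply', norm_mul, norm_norm]
    exact mul_le_mul_of_nonneg_left (hgkb _) (norm_nonneg _)
  have key := convolution_assoc L₁ L₂ L₂ L₂ (fun A B x => rfl) (x₀ := t) hKi.aestronglyMeasurable
    hSi.aestronglyMeasurable hui.aestronglyMeasurable (hKi.ae_convolution_exists L₁ hSi)
    (Eventually.of_forall hgk) hfgk
  have h1 : convolution K' (convolution S' u' L₂ volume) L₂ volume t =
      opConv K (opConv S u) t := by
    rw [convolution_def, opConv, intervalIntegral.integral_of_le ht.1,
      ← integral_Icc_eq_integral_Ioc, ← integral_indicator measurableSet_Icc]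
    congr 1
    ext s
    by_cases hs : s ∈ Icc 0 t
    · rw [indicator_of_mem hs, hK', indicator_of_mem (show s ∈ Icc 0 T from ⟨hs.1, hs.2.trans ht.2⟩),
        truncated_convolution S u L₂ (by linarith [hs.2]) (by linarith [hs.1, ht.2])]
      rfl
    · rw [indicator_of_notMem hs]
      by_cases hs' : s ∈ Icc 0 T
      · have hneg : t - s < 0 := by
          by_contra! h0
          exact hs ⟨hs'.1, by linarith⟩
        have : convolution S' u' L₂ volume (t - s) = 0 := by
          rw [convolution_def]
          simp_rw [hS', hu', truncated_convolution_integrand S u L₂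
            (show t - s ≤ T by linarith [ht.1, ht.2, hs'.1])]
          rw [Icc_eq_empty (not_le.2 hneg)]
          simp
        rw [this, map_zero]
      · rw [hK', indicator_of_notMem hs', map_zero, zero_apply]
  have h2 : convolution (convolution K' S' L₁ volume) u' L₂ volume t =
      opConv (opMul K S) u t := by
    rw [convolution_def, opConv, intervalIntegral.integral_of_le ht.1,
      ← integral_Icc_eq_integral_Ioc, ← integral_indicator measurableSet_Icc]
    congr 1
    ext s
    by_cases hs : s ∈ Icc 0 t
    · rw [indicator_of_mem hs, hu', indicator_of_mem (show t - s ∈ Icc 0 T from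
        ⟨by linarith [hs.2], by linarith [hs.1, ht.2]⟩),
        truncated_convolution K S L₁ hs.1 (hs.2.trans ht.2)]
      rfl
    · rw [indicator_of_notMem hs]
      by_cases hs' : t - s ∈ Icc 0 T
      · have hneg : s < 0 := by
          by_contra! h0
          exact hs ⟨h0, by linarith [hs'.1]⟩
        have : convolution K' S' L₁ volume s = 0 := by
          rw [convolution_def]
          simp_rw [hK', hS', truncated_convolution_integrand K S L₁
            (show s ≤ T by linarith [ht.1, ht.2])]
          rw [Icc_eq_empty (not_le.2 hneg)]
          simp
        rw [this, map_zero, zero_apply]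
      · rw [hu', indicator_of_notMem hs', map_zero]
  rw [← h1, ← h2, key]

/-- Freezing `u` at `u 0` for `s > t` gives a domain independent of `t`, so dominated convergence
yields continuity and the limit at infinity; the price is the tail of `∫ S` applied to `u 0`. -/
theorem opConv_eq_integral_Ioi {S : ℝ → E →L[ℝ] E} (hS : IntegrableOn S (Ioi 0)) {u : ℝ → E}
    (hu : Continuous u) {C : ℝ} (hC : ∀ s, ‖u s‖ ≤ C) {t : ℝ} (ht : 0 ≤ t) :
    opConv S u t = (∫ s in Ioi (0 : ℝ), S s (u (max (t - s) 0))) -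
      ((∫ s in Ioi (0 : ℝ), S s) - ∫ s in 0..t, S s) (u 0) := by
  have hint : IntegrableOn (fun s => S s (u (max (t - s) 0))) (Ioi 0) := by
    refine (hS.norm.mul_const C).mono' ?_ (Eventually.of_forall fun s => ?_)
    · refine (ContinuousLinearMap.id ℝ (E →L[ℝ] E)).aestronglyMeasurable_comp₂
        hS.aestronglyMeasurable ?_
      exact (by fun_prop : Continuous fun s => u (max (t - s) 0)).aestronglyMeasurable
    · exact ((S s).le_opNorm _).trans (mul_le_mul_of_nonneg_left (hC _) (norm_nonneg _))
  have hun : Ioc 0 t ∪ Ioi t = Ioi 0 := Ioc_union_Ioi_eq_Ioi ht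
  have hdisj : Disjoint (Ioc 0 t) (Ioi t) := Ioc_disjoint_Ioi le_rfl
  have h1 := hint.mono_set (hun ▸ subset_union_left : Ioc 0 t ⊆ Ioi 0)
  have h2 := hint.mono_set (hun ▸ subset_union_right : Ioi t ⊆ Ioi 0)
  have h3 := hS.mono_set (hun ▸ subset_union_left : Ioc 0 t ⊆ Ioi 0)
  have h4 := hS.mono_set (hun ▸ subset_union_right : Ioi t ⊆ Ioi 0)
  have e1 : ∫ s in Ioi (0 : ℝ), S s (u (max (t - s) 0)) =
      opConv S u t + (∫ s in Ioi t, S s) (u 0) := by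
    rw [← hun, setIntegral_union hdisj measurableSet_Ioi h1 h2, opConv,
      intervalIntegral.integral_of_le ht, ContinuousLinearMap.integral_apply h4]
    congr 1
    · refine setIntegral_congr_fun measurableSet_Ioc fun s hs => ?_
      simp only [max_eq_left (by linarith [hs.2] : 0 ≤ t - s)]
    · refine setIntegral_congr_fun measurableSet_Ioi fun s hs => ?_
      have hs : t < s := hs
      simp only [max_eq_right (by linarith : t - s ≤ 0)]
  have e2 : ∫ s in Ioi (0 : ℝ), S s = (∫ s in 0..t, S s) + ∫ s in Ioi t, S s := by
    rw [← hun, setIntegral_union hdisj measurableSet_Ioi h3 h4, intervalIntegral.integral_of_le ht]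
  rw [e1, e2, add_sub_cancel_left, add_sub_cancel_right]

theorem tendsto_opConv_atTop {S : ℝ → E →L[ℝ] E} (hS : IntegrableOn S (Ioi 0))
    {u : ℝ → E} (hu : Continuous u) {C : ℝ} (hC : ∀ s, ‖u s‖ ≤ C) (hu₀ : Tendsto u atTop (𝓝 0)) :
    Tendsto (opConv S u) atTop (𝓝 0) := by
  have h1 : Tendsto (fun t => ∫ s in Ioi (0 : ℝ), S s (u (max (t - s) 0))) atTop (𝓝 0) := by
    have := tendsto_integral_filter_of_dominated_convergence
      (μ := volume.restrict (Ioi (0 : ℝ))) (l := atTop) (F := fun t s => S s (u (max (t - s) 0)))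
      (f := fun _ => 0) (fun s => ‖S s‖ * C) ?_ ?_ (hS.norm.mul_const C) ?_
    · simpa using this
    · refine Eventually.of_forall fun t => ?_
      refine (ContinuousLinearMap.id ℝ (E →L[ℝ] E)).aestronglyMeasurable_comp₂
        hS.aestronglyMeasurable ?_
      exact (by fun_prop : Continuous fun s => u (max (t - s) 0)).aestronglyMeasurable
    · exact Eventually.of_forall fun t => Eventually.of_forall fun s =>
        ((S s).le_opNorm _).trans (mul_le_mul_of_nonneg_left (hC _) (norm_nonneg _))
    · refine Eventually.of_forall fun s => ?_
      have h2 : Tendsto (fun t : ℝ => max (t - s) 0) atTop atTop :=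
        tendsto_atTop_mono (fun t => le_max_left _ _)
          (by simpa [sub_eq_add_neg] using tendsto_atTop_add_const_right atTop (-s) tendsto_id)
      exact ((S s).continuous.tendsto' 0 0 (map_zero _)).comp (hu₀.comp h2)
  have h2 : Tendsto (fun t => ∫ s in 0..t, S s) atTop (𝓝 (∫ s in Ioi (0 : ℝ), S s)) :=
    intervalIntegral_tendsto_integral_Ioi 0 hS tendsto_id
  have h3 : Tendsto (fun t => ((∫ s in Ioi (0 : ℝ), S s) - ∫ s in 0..t, S s) (u 0)) atTop
      (𝓝 0) := by
    have h5 := h2.const_sub (∫ s in Ioi (0 : ℝ), S s)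
    rw [sub_self] at h5
    have h6 : Continuous fun R : E →L[ℝ] E => R (u 0) := by fun_prop
    exact (h6.tendsto' 0 0 rfl).comp h5
  have h4 := h1.sub h3
  rw [sub_zero] at h4
  refine h4.congr' ?_
  filter_upwards [eventually_ge_atTop 0] with t ht using (opConv_eq_integral_Ioi hS hu hC ht).symm

theorem continuous_integral_kernel {S : ℝ → E →L[ℝ] E} (hS : IntegrableOn S (Ioi 0)) :
    ContinuousOn (fun t => ∫ s in 0..t, S s) (Ici 0) := by
  intro t ht
  have hT : IntegrableOn S (uIcc 0 (t + 1)) := by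
    rw [uIcc_of_le (by linarith [mem_Ici.1 ht])]
    exact integrableOn_Icc_of_integrableOn_Ioi hS _
  have := intervalIntegral.continuousOn_primitive_interval hT
  rw [uIcc_of_le (by linarith [mem_Ici.1 ht])] at this
  refine (this t ⟨ht, by linarith⟩).mono_of_mem_nhdsWithin ?_
  filter_upwards [self_mem_nhdsWithin, mem_nhdsWithin_of_mem_nhds (Iio_mem_nhds (lt_add_one t))]
    with s hs hs' using ⟨hs, le_of_lt hs'⟩

theorem continuousOn_opConv_of_continuous {S : ℝ → E →L[ℝ] E} (hS : IntegrableOn S (Ioi 0))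
    {u : ℝ → E} (hu : Continuous u) {C : ℝ} (hC : ∀ s, ‖u s‖ ≤ C) :
    ContinuousOn (opConv S u) (Ici 0) := by
  have h1 : Continuous fun t => ∫ s in Ioi (0 : ℝ), S s (u (max (t - s) 0)) := by
    refine continuous_of_dominated (bound := fun s => ‖S s‖ * C) (fun t => ?_) (fun t => ?_)
      (hS.norm.mul_const C) ?_
    · refine (ContinuousLinearMap.id ℝ (E →L[ℝ] E)).aestronglyMeasurable_comp₂
        hS.aestronglyMeasurable ?_
      exact (by fun_prop : Continuous fun s => u (max (t - s) 0)).aestronglyMeasurable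
    · exact Eventually.of_forall fun s =>
        ((S s).le_opNorm _).trans (mul_le_mul_of_nonneg_left (hC _) (norm_nonneg _))
    · exact Eventually.of_forall fun s => by fun_prop
  have h2 := (continuousOn_const (c := ∫ s in Ioi (0 : ℝ), S s)).sub (continuous_integral_kernel hS)
  refine (h1.continuousOn.sub (h2.clm_apply (continuousOn_const (c := u 0)))).congr fun t ht => ?_
  exact opConv_eq_integral_Ioi hS hu hC ht

theorem continuousOn_opConv {S : ℝ → E →L[ℝ] E} (hS : IntegrableOn S (Ioi 0)) {u : ℝ → E} {T : ℝ}
    (hT : 0 ≤ T) (hu : ContinuousOn u (Icc 0 T)) : ContinuousOn (opConv S u) (Icc 0 T) := by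
  obtain ⟨C, hC⟩ := isCompact_Icc.exists_bound_of_continuousOn hu
  have h1 := continuousOn_opConv_of_continuous hS (u := IccExtend hT ((Icc 0 T).domRestrict u))
    (continuousOn_iff_continuous_domRestrict.1 hu).Icc_extend' (C := C) fun s => hC _ (projIcc 0 T hT s).2
  refine (h1.mono Icc_subset_Ici_self).congr fun t ht => ?_
  refine opConv_congr ht.1 fun s hs => ?_
  exact (IccExtend_of_mem hT ((Icc 0 T).domRestrict u) ⟨hs.1, hs.2.trans ht.2⟩).symm

end OperatorConvolution

theorem integrableOn_abelKernel {α : ℝ} (hα₁ : α < 1) (T : ℝ) :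
    IntegrableOn (abelKernel α) (Icc 0 T) := by
  rcases le_or_gt 0 T with hT | hT
  · rw [integrableOn_Icc_iff_integrableOn_Ioc]
    have h : IntervalIntegrable (fun s : ℝ => s ^ (-α)) volume 0 T :=
      intervalIntegral.intervalIntegrable_rpow' (by linarith)
    exact Integrable.div_const ((intervalIntegrable_iff_integrableOn_Ioc_of_le hT).1 h) _
  · rw [Icc_eq_empty (not_le.2 hT)]
    exact integrableOn_empty

/-! ### From complex operators to real matrices -/

section RealKernel

variable {d : ℕ}

/-- The inclusion of real vectors into complex vectors. -/
noncomputable def complexifyVec (d : ℕ) :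
    EuclideanSpace ℝ (Fin d) →L[ℝ] EuclideanSpace ℂ (Fin d) :=
  LinearMap.toContinuousLinearMap
    { toFun := fun x => WithLp.toLp 2 fun i => (x i : ℂ)
      map_add' := fun x y => by ext i; simp
      map_smul' := fun r x => by ext i; simp }

/-- The real part of a complex vector. -/
noncomputable def realPartVec (d : ℕ) :
    EuclideanSpace ℂ (Fin d) →L[ℝ] EuclideanSpace ℝ (Fin d) :=
  LinearMap.toContinuousLinearMap
    { toFun := fun x => WithLp.toLp 2 fun i => (x i).re
      map_add' := fun x y => by ext i; simp
      map_smul' := fun r x => by ext i; simp }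

theorem realPartVec_complexifyVec (x : EuclideanSpace ℝ (Fin d)) :
    realPartVec d (complexifyVec d x) = x := by
  ext i
  simp [realPartVec, complexifyVec]

theorem toEuclideanCLM_complexifyVec (A : Matrix (Fin d) (Fin d) ℝ) (x : EuclideanSpace ℝ (Fin d)) :
    Matrix.toEuclideanCLM (𝕜 := ℂ) (A.map (algebraMap ℝ ℂ)) (complexifyVec d x) =
      complexifyVec d (Matrix.toEuclideanCLM (𝕜 := ℝ) A x) := by
  ext i
  simp [complexifyVec, Matrix.mulVec, dotProduct]

theorem realPartVec_toEuclideanCLM (A : Matrix (Fin d) (Fin d) ℝ) (x : EuclideanSpace ℂ (Fin d)) :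
    realPartVec d (Matrix.toEuclideanCLM (𝕜 := ℂ) (A.map (algebraMap ℝ ℂ)) x) =
      Matrix.toEuclideanCLM (𝕜 := ℝ) A (realPartVec d x) := by
  ext i
  simp [realPartVec, Matrix.mulVec, dotProduct]

/-- The real part of a complex operator. -/
noncomputable def realPartCLM (d : ℕ) :
    (EuclideanSpace ℂ (Fin d) →L[ℂ] EuclideanSpace ℂ (Fin d)) →L[ℝ]
      (EuclideanSpace ℝ (Fin d) →L[ℝ] EuclideanSpace ℝ (Fin d)) :=
  (ContinuousLinearMap.compL ℝ (EuclideanSpace ℝ (Fin d)) (EuclideanSpace ℂ (Fin d))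
      (EuclideanSpace ℝ (Fin d)) (realPartVec d)).comp
    (((ContinuousLinearMap.compL ℝ (EuclideanSpace ℝ (Fin d)) (EuclideanSpace ℂ (Fin d))
      (EuclideanSpace ℂ (Fin d))).flip (complexifyVec d)).comp
      (ContinuousLinearMap.restrictScalarsL ℂ (EuclideanSpace ℂ (Fin d))
        (EuclideanSpace ℂ (Fin d)) ℝ ℝ))

theorem finite_spectrum_complexify (A : Matrix (Fin d) (Fin d) ℝ) :
    (spectrum ℂ (A.map (algebraMap ℝ ℂ))).Finite :=
  Matrix.finite_spectrum _

/-- Finitely many strict inequalities at `φ = π / 2` persist slightly beyond it. -/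
theorem exists_sector_angle {α : ℝ} {s : Set ℂ} (hs : s.Finite)
    (h : ∀ μ ∈ s, α * Real.pi / 2 < |Complex.arg μ|) :
    ∃ φ : ℝ, Real.pi / 2 < φ ∧ φ < Real.pi ∧ ∀ μ ∈ s, α * φ ≤ |Complex.arg μ| := by
  have h1 : ∀ᶠ φ in 𝓝[>] (Real.pi / 2), ∀ μ ∈ s, α * φ < |Complex.arg μ| := by
    refine (eventually_all_finite hs).2 fun μ hμ => ?_
    have : Continuous fun φ : ℝ => α * φ := by fun_prop
    refine ((this.tendsto' (Real.pi / 2) (α * Real.pi / 2) (by ring)).mono_left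
      nhdsWithin_le_nhds).eventually_lt_const (h μ hμ)
  have h2 : ∀ᶠ φ in 𝓝[>] (Real.pi / 2), φ ∈ Ioo (Real.pi / 2) Real.pi :=
    Ioo_mem_nhdsGT (by linarith [Real.pi_pos])
  obtain ⟨φ, h3, h4⟩ := (h1.and h2).exists
  exact ⟨φ, h4.1, h4.2, fun μ hμ => (h3 μ hμ).le⟩

/-- The fundamental solution of the linear fractional equation with a stable real matrix. -/
theorem exists_integrableOn_real_kernel {α : ℝ} (hα₀ : 0 < α) (hα₁ : α < 1)
    (A : Matrix (Fin d) (Fin d) ℝ)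
    (hA : ∀ μ ∈ spectrum ℂ (A.map (algebraMap ℝ ℂ)), α * Real.pi / 2 < |Complex.arg μ|) :
    ∃ S : ℝ → (EuclideanSpace ℝ (Fin d) →L[ℝ] EuclideanSpace ℝ (Fin d)),
      IntegrableOn S (Ioi 0) ∧
      (∫ t in Ioi (0 : ℝ), S t) * Matrix.toEuclideanCLM (𝕜 := ℝ) A = -1 ∧
      (∀ᵐ t, t ∈ Ioi (0 : ℝ) → ∫ s in 0..t, abelKernel α s • S (t - s) =
        1 + Matrix.toEuclideanCLM (𝕜 := ℝ) A * ∫ s in 0..t, S s) ∧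
      (∀ᵐ t, t ∈ Ioi (0 : ℝ) → ∫ s in 0..t, abelKernel α s • S (t - s) =
        1 + (∫ s in 0..t, S s) * Matrix.toEuclideanCLM (𝕜 := ℝ) A) := by
  set a := Matrix.toEuclideanCLM (𝕜 := ℂ) (A.map (algebraMap ℝ ℂ)) with ha
  set b := Matrix.toEuclideanCLM (𝕜 := ℝ) A with hb
  obtain ⟨φ, hφ₁, hφ₂, hφ⟩ := exists_sector_angle (finite_spectrum_complexify A) hA
  have hspec : spectrum ℂ a = spectrum ℂ (A.map (algebraMap ℝ ℂ)) :=
    AlgEquiv.spectrum_eq (Matrix.toEuclideanCLM (n := Fin d) (𝕜 := ℂ)) _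
  rw [← hspec] at hφ hA
  -- Because `Complex.arg 0 = 0`, the strict inequality `hA` also excludes the eigenvalue `0`.
  have hunit : IsUnit a := by
    by_contra h
    have := hA 0 ((spectrum.zero_mem_iff ℂ).2 h)
    rw [Complex.arg_zero, abs_zero] at this
    have := mul_pos hα₀ Real.pi_pos
    linarith
  obtain ⟨S, hS, h1, h2, h3⟩ := exists_integrableOn_resolvent_kernel hα₀ hα₁ hφ₁ hφ₂ hφ hunit
  -- Taking real parts is not multiplicative, but it respects left and right multiplication by a
  -- real matrix, which is all the identities involve.
  have hleft : ∀ T, realPartCLM d (a * T) = b * realPartCLM d T := fun T => by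
    ext1 x
    exact realPartVec_toEuclideanCLM A _
  have hright : ∀ T, realPartCLM d (T * a) = realPartCLM d T * b := fun T => by
    ext1 x
    change realPartVec d (T (a (complexifyVec d x))) = realPartVec d (T (complexifyVec d (b x)))
    rw [ha, toEuclideanCLM_complexifyVec]
  have hone : realPartCLM d 1 = 1 := by
    ext1 x
    exact realPartVec_complexifyVec x
  have hk : ∀ T, IntegrableOn (abelKernel α) (Icc 0 T) := integrableOn_abelKernel hα₁
  have hSi : ∀ t : ℝ, 0 < t → IntervalIntegrable S volume 0 t := fun t ht =>
    (intervalIntegrable_iff_integrableOn_Ioc_of_le ht.le).2 (hS.mono_set Ioc_subset_Ioi_self)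
  have hint : ∀ t : ℝ, 0 < t →
      realPartCLM d (∫ s in 0..t, S s) = ∫ s in 0..t, realPartCLM d (S s) := fun t ht =>
    ((realPartCLM d).intervalIntegral_comp_comm (hSi t ht)).symm
  have hconv : ∀ᵐ t, t ∈ Ioi (0 : ℝ) → realPartCLM d (∫ s in 0..t, abelKernel α s • S (t - s)) =
      ∫ s in 0..t, abelKernel α s • realPartCLM d (S (t - s)) := by
    filter_upwards [ae_intervalIntegrable_convolution (ContinuousLinearMap.lsmul ℝ ℝ) hk
      (integrableOn_Icc_of_integrableOn_Ioi hS)] with t ht ht₀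
    have := (realPartCLM d).intervalIntegral_comp_comm (ht ht₀)
    simp only [ContinuousLinearMap.lsmul_apply, map_smul] at this
    exact this.symm
  refine ⟨fun t => realPartCLM d (S t), (realPartCLM d).integrable_comp hS, ?_, ?_, ?_⟩
  · rw [(realPartCLM d).integral_comp_comm hS, ← hright, h1, map_neg, hone]
  · filter_upwards [h2, hconv] with t ht ht' ht₀
    rw [← ht' ht₀, ht ht₀, map_add, hone, hleft, hint t ht₀]
  · filter_upwards [h3, hconv] with t ht ht' ht₀
    rw [← ht' ht₀, ht ht₀, map_add, hone, hright, hint t ht₀]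

end RealKernel

theorem integrableOn_const_Icc {X : Type*} [NormedAddCommGroup X] (b : X) (T : ℝ) :
    IntegrableOn (fun _ : ℝ => b) (Icc 0 T) :=
  (continuousOn_const (c := b)).integrableOn_Icc

/-! ### Variation of constants for the integrated linear equation -/

section Volterra

variable {E : Type*} [NormedAddCommGroup E] [NormedSpace ℝ E]

theorem opConv_const (a : E →L[ℝ] E) (u : ℝ → E) (t : ℝ) :
    opConv (fun _ => a) u t = ∫ s in 0..t, a (u s) := by
  have h1 := intervalIntegral.integral_comp_sub_left (fun s => a (u s)) (a := 0) (b := t) t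
  simpa only [opConv, sub_zero, sub_self] using h1

theorem intervalIntegrable_kernel_apply {S : ℝ → E →L[ℝ] E} (hS : IntegrableOn S (Ioi 0))
    {w : ℝ → E} {t : ℝ} (ht : 0 ≤ t) (hw : ContinuousOn w (Icc 0 t)) :
    IntervalIntegrable (fun s => S s (w (t - s))) volume 0 t := by
  obtain ⟨C, hC⟩ := isCompact_Icc.exists_bound_of_continuousOn hw
  have hw' : ContinuousOn (fun s => w (t - s)) (Icc 0 t) :=
    hw.comp (by fun_prop) fun s hs => ⟨by linarith [hs.2], by linarith [hs.1]⟩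
  have hS' : IntegrableOn S (Ioc 0 t) := hS.mono_set Ioc_subset_Ioi_self
  refine (intervalIntegrable_iff_integrableOn_Ioc_of_le ht).2 ((hS'.norm.mul_const C).mono' ?_ ?_)
  · refine (ContinuousLinearMap.id ℝ (E →L[ℝ] E)).aestronglyMeasurable_comp₂
      hS'.aestronglyMeasurable ?_
    exact (hw'.mono Ioc_subset_Icc_self).aestronglyMeasurable measurableSet_Ioc
  · refine (ae_restrict_mem measurableSet_Ioc).mono fun s hs => ((S s).le_opNorm _).trans ?_
    exact mul_le_mul_of_nonneg_left (hC _ ⟨by linarith [hs.2], by linarith [hs.1]⟩) (norm_nonneg _)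

theorem opConv_one_add {W : ℝ → E →L[ℝ] E} {u : ℝ → E} {t : ℝ} (ht : 0 ≤ t)
    (hW : ContinuousOn W (Icc 0 t)) (hu : ContinuousOn u (Icc 0 t)) :
    opConv (fun s => 1 + W s) u t = (∫ s in 0..t, u s) + opConv W u t := by
  have hu' : ContinuousOn (fun s => u (t - s)) (Icc 0 t) :=
    hu.comp (by fun_prop) fun s hs => ⟨by linarith [hs.2], by linarith [hs.1]⟩
  have h1 := intervalIntegral.integral_comp_sub_left u (a := 0) (b := t) t
  simp only [sub_zero, sub_self] at h1
  rw [← h1, opConv, opConv, ← intervalIntegral.integral_add]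
  · rfl
  · exact hu'.intervalIntegrable_of_Icc ht
  · exact (hW.clm_apply hu').intervalIntegrable_of_Icc ht

variable [CompleteSpace E]

theorem opMul_const_left (a : E →L[ℝ] E) {S : ℝ → E →L[ℝ] E} (hS : IntegrableOn S (Ioi 0))
    {t : ℝ} (ht : 0 ≤ t) : opMul (fun _ => a) S t = a * ∫ s in 0..t, S s := by
  have hSi : IntervalIntegrable S volume 0 t :=
    (intervalIntegrable_iff_integrableOn_Ioc_of_le ht).2 (hS.mono_set Ioc_subset_Ioi_self)
  have h1 := intervalIntegral.integral_comp_sub_left (fun s => a * S s) (a := 0) (b := t) t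
  simp only [sub_zero, sub_self] at h1
  rw [opMul, h1]
  exact (ContinuousLinearMap.mul ℝ (E →L[ℝ] E) a).intervalIntegral_comp_comm hSi

theorem opMul_const_right (a : E →L[ℝ] E) {S : ℝ → E →L[ℝ] E} (hS : IntegrableOn S (Ioi 0))
    {t : ℝ} (ht : 0 ≤ t) : opMul S (fun _ => a) t = (∫ s in 0..t, S s) * a := by
  have hSi : IntervalIntegrable S volume 0 t :=
    (intervalIntegrable_iff_integrableOn_Ioc_of_le ht).2 (hS.mono_set Ioc_subset_Ioi_self)
  exact ((ContinuousLinearMap.mul ℝ (E →L[ℝ] E)).flip a).intervalIntegral_comp_comm hSi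

/-- Differentiation gives equality on the open interval; continuity adds the endpoints. -/
theorem eqOn_of_primitive_eq {u v : ℝ → E} {T : ℝ}
    (hu : ContinuousOn u (Icc 0 T)) (hv : ContinuousOn v (Icc 0 T))
    (h : ∀ t ∈ Icc 0 T, ∫ s in 0..t, u s = ∫ s in 0..t, v s) (hT : 0 < T) :
    EqOn u v (Icc 0 T) := by
  have hderiv : ∀ w : ℝ → E, ContinuousOn w (Icc 0 T) → ∀ t ∈ Ioo 0 T,
      HasDerivAt (fun t => ∫ s in 0..t, w s) (w t) t := fun w hw t ht =>
    intervalIntegral.integral_hasDerivAt_right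
      ((hw.mono (Icc_subset_Icc_right ht.2.le)).intervalIntegrable_of_Icc ht.1.le)
      ((hw.mono Ioo_subset_Icc_self).stronglyMeasurableAtFilter isOpen_Ioo t ht)
      (hw.continuousAt (Icc_mem_nhds ht.1 ht.2))
  have hIoo : EqOn u v (Ioo 0 T) := by
    intro t ht
    refine (hderiv u hu t ht).unique ((hderiv v hv t ht).congr_of_eventuallyEq ?_)
    filter_upwards [Ioo_mem_nhds ht.1 ht.2] with s hs using h s ⟨hs.1.le, hs.2.le⟩
  exact hIoo.of_subset_closure hu hv Ioo_subset_Icc_self (closure_Ioo hT.ne).symm.subset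

variable {a : E →L[ℝ] E} {k : ℝ → ℝ} {S : ℝ → E →L[ℝ] E}

/-- The variation of constants formula gives a solution of the integrated linear equation. -/
theorem integral_smul_eq_of_eq_opConv (hk : ∀ T, IntegrableOn k (Icc 0 T))
    (hS : IntegrableOn S (Ioi 0))
    (hkS : ∀ᵐ t, t ∈ Ioi (0 : ℝ) → ∫ s in 0..t, k s • S (t - s) = 1 + a * ∫ s in 0..t, S s)
    {T : ℝ} {y h : ℝ → E} (hh : ContinuousOn h (Icc 0 T))
    (hy : EqOn y (opConv S h) (Icc 0 T)) {t : ℝ} (ht : t ∈ Icc 0 T) :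
    ∫ s in 0..t, k s • y (t - s) = ∫ s in 0..t, (a (y s) + h s) := by
  have hT : 0 ≤ T := ht.1.trans ht.2
  have hkop : IntegrableOn (fun s => k s • (1 : E →L[ℝ] E)) (Icc 0 T) := (hk T).smul_const _
  have hSI : IntegrableOn S (Icc 0 T) := integrableOn_Icc_of_integrableOn_Ioi hS T
  have hcI : IntegrableOn (fun _ : ℝ => a) (Icc 0 T) := integrableOn_const_Icc _ _
  have hht : ContinuousOn h (Icc 0 t) := hh.mono (Icc_subset_Icc_right ht.2)
  have hyt : ∀ s ∈ Icc 0 t, y s = opConv S h s := fun s hs => hy ⟨hs.1, hs.2.trans ht.2⟩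
  have hyc : ContinuousOn y (Icc 0 t) :=
    ((continuousOn_opConv hS hT hh).congr hy).mono (Icc_subset_Icc_right ht.2)
  have hW : ContinuousOn (opMul (fun _ => a) S) (Icc 0 t) := by
    have : ContinuousOn (fun t => a * ∫ s in 0..t, S s) (Icc 0 t) :=
      continuousOn_const.mul ((continuous_integral_kernel hS).mono Icc_subset_Ici_self)
    exact this.congr fun s hs => opMul_const_left a hS hs.1
  have h1 : ∫ s in 0..t, k s • y (t - s) = opConv (fun s => k s • 1) y t := rfl
  -- With `1` also denoting the constant function: `k * (S * h) = (k * S) * h = (1 + a * S) * h = ∫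
  -- h + a * (S * h)`.
  rw [h1, opConv_congr ht.1 hyt, opConv_opConv hkop hSI hh ht,
    opConv_congr_left (L := fun s => 1 + opMul (fun _ => a) S s) ht.1 ?_, opConv_one_add ht.1 hW hht,
    ← opConv_opConv hcI hSI hh ht, ← opConv_congr ht.1 hyt, opConv_const,
    intervalIntegral.integral_add, add_comm]
  · exact (a.continuous.comp_continuousOn hyc).intervalIntegrable_of_Icc ht.1
  · exact hht.intervalIntegrable_of_Icc ht.1
  · filter_upwards [hkS] with s hs hs₀
    rw [opMul_const_left a hS (le_of_lt hs₀), ← hs hs₀]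
    simp [opMul]

/-- The variation of constants formula represents every solution of the integrated linear
equation. -/
theorem eq_opConv_of_integral_smul_eq (hk : ∀ T, IntegrableOn k (Icc 0 T))
    (hS : IntegrableOn S (Ioi 0))
    (hkS : ∀ᵐ t, t ∈ Ioi (0 : ℝ) → ∫ s in 0..t, k s • S (t - s) = 1 + (∫ s in 0..t, S s) * a)
    {T : ℝ} (hT : 0 < T) {y h : ℝ → E} (hh : ContinuousOn h (Icc 0 T))
    (hyc : ContinuousOn y (Icc 0 T))
    (hy : ∀ t ∈ Icc 0 T, ∫ s in 0..t, k s • y (t - s) = ∫ s in 0..t, (a (y s) + h s)) :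
    EqOn y (opConv S h) (Icc 0 T) := by
  refine eqOn_of_primitive_eq hyc (continuousOn_opConv hS hT.le hh)
    (fun t ht => ?_) hT
  have hkop : IntegrableOn (fun s => k s • (1 : E →L[ℝ] E)) (Icc 0 T) := (hk T).smul_const _
  have hSI : IntegrableOn S (Icc 0 T) := integrableOn_Icc_of_integrableOn_Ioi hS T
  have hcI : ∀ b : E →L[ℝ] E, IntegrableOn (fun _ : ℝ => b) (Icc 0 T) := fun b =>
    integrableOn_const_Icc _ _
  have hsub : Icc 0 t ⊆ Icc 0 T := Icc_subset_Icc_right ht.2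
  have hW : ContinuousOn (opMul S (fun _ => a)) (Icc 0 t) := by
    have : ContinuousOn (fun t => (∫ s in 0..t, S s) * a) (Icc 0 t) :=
      ((continuous_integral_kernel hS).mono Icc_subset_Ici_self).mul continuousOn_const
    exact this.congr fun s hs => opMul_const_right a hS hs.1
  have hay : ContinuousOn (fun s => a (y s)) (Icc 0 T) := a.continuous.comp_continuousOn hyc
  have hprim : ∀ u : ℝ → E, ContinuousOn u (Icc 0 T) →
      ContinuousOn (fun t => ∫ s in 0..t, u s) (Icc 0 T) := fun u hu => by
    have := intervalIntegral.continuousOn_primitive_interval (f := u) (μ := volume) (a := 0) (b := T)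
      (by rw [uIcc_of_le hT.le]; exact hu.integrableOn_Icc)
    rwa [uIcc_of_le hT.le] at this
  have hswap : ∀ s, 0 ≤ s → opMul S (fun s => k s • 1) s = ∫ r in 0..s, k r • S (s - r) := by
    intro s _
    have h1 := intervalIntegral.integral_comp_sub_left (fun r => k r • S (s - r)) (a := 0) (b := s) s
    simp only [sub_zero, sub_self, sub_sub_cancel] at h1
    rw [← h1, opMul]
    simp
  -- `S * k * y` is computed twice: through `S * k = 1 + (∫ S) a`, and through the equation for `k *
  -- y`. The common term `S * (a * y)` cancels and leaves `∫ y = S * (1 * h) = ∫ (S * h)`.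
  have e1 : opConv S (opConv (fun s => k s • 1) y) t =
      (∫ s in 0..t, y s) + opConv S (opConv (fun _ => a) y) t := by
    rw [opConv_opConv hSI hkop hyc ht,
      opConv_congr_left (L := fun s => 1 + opMul S (fun _ => a) s) ht.1 ?_,
      opConv_one_add ht.1 hW (hyc.mono hsub), opConv_opConv hSI (hcI a) hyc ht]
    filter_upwards [hkS] with s hs hs₀
    rw [opMul_const_right a hS (le_of_lt hs₀), ← hs hs₀, hswap s (le_of_lt hs₀)]
  have e2 : opConv S (opConv (fun s => k s • 1) y) t =
      opConv S (opConv (fun _ => a) y) t + opConv S (opConv (fun _ => 1) h) t := by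
    have h2 : ∀ s ∈ Icc 0 t, opConv (fun s => k s • 1) y s =
        opConv (fun _ => a) y s + opConv (fun _ => 1) h s := by
      intro s hs
      have hs' := hsub hs
      have h3 : opConv (fun s => k s • 1) y s = ∫ r in 0..s, k r • y (s - r) := rfl
      rw [h3, hy s hs', opConv_const, opConv_const, intervalIntegral.integral_add]
      · rfl
      · exact (hay.mono (Icc_subset_Icc_right hs'.2)).intervalIntegrable_of_Icc hs.1
      · exact (hh.mono (Icc_subset_Icc_right hs'.2)).intervalIntegrable_of_Icc hs.1
    rw [opConv_congr ht.1 h2]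
    have hI : ∀ b : E →L[ℝ] E, ∀ u : ℝ → E, ContinuousOn u (Icc 0 T) →
        IntervalIntegrable (fun s => S s (opConv (fun _ => b) u (t - s))) volume 0 t := by
      intro b u hu
      refine intervalIntegrable_kernel_apply hS ht.1 ?_
      exact ((hprim _ (b.continuous.comp_continuousOn hu)).mono hsub).congr fun s _ =>
        opConv_const b u s
    simp only [opConv, map_add]
    exact intervalIntegral.integral_add (hI a y hyc) (hI 1 h hh)
  have e3 : opConv S (opConv (fun _ => 1) h) t = ∫ s in 0..t, opConv S h s := by
    rw [opConv_opConv hSI (hcI 1) hh ht,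
      opConv_congr_left (L := opMul (fun _ => 1) S) ht.1 ?_, ← opConv_opConv (hcI 1) hSI hh ht,
      opConv_const]
    · rfl
    · refine Eventually.of_forall fun s hs => ?_
      rw [opMul_const_left 1 hS (le_of_lt hs), opMul_const_right 1 hS (le_of_lt hs), one_mul,
        mul_one]
  rw [← e3]
  rw [e2, add_comm] at e1
  exact (add_right_cancel e1).symm

end Volterra

/-! ### The nonlinear Volterra equation -/

theorem exists_lipschitzOnWith_of_lipConst {E : Type*} [NormedAddCommGroup E] {f : E → E}
    (hlim : Tendsto (lipConst f) (𝓝[>] 0) (𝓝 0)) {η : NNReal} (hη : 0 < η) :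
    ∃ r : ℝ, 0 < r ∧ LipschitzOnWith η f (Metric.closedBall 0 r) := by
  have h1 : ∀ᶠ r in 𝓝[>] (0 : ℝ), lipConst f r < η :=
    hlim.eventually_lt_const (by simpa using hη)
  obtain ⟨r, hr, hr₀⟩ := (h1.and self_mem_nhdsWithin).exists
  refine ⟨r, hr₀, fun x hx y hy => ?_⟩
  rcases eq_or_ne x y with rfl | hne
  · simp
  · have h2 : edist (f x) (f y) / edist x y ≤ lipConst f r :=
      le_iSup₂_of_le (f := fun x (_ : x ∈ Metric.closedBall (0 : E) r) =>
        ⨆ y ∈ Metric.closedBall (0 : E) r, edist (f x) (f y) / edist x y) x hx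
        (le_iSup₂_of_le (f := fun y (_ : y ∈ Metric.closedBall (0 : E) r) =>
          edist (f x) (f y) / edist x y) y hy le_rfl)
    exact (ENNReal.div_le_iff (edist_pos.2 hne).ne' (edist_ne_top x y)).1 (h2.trans hr.le)

section FixedPoint

variable {E : Type*} [NormedAddCommGroup E] [NormedSpace ℝ E]

/-- Only `u (t - s)` with `s > 0` enters, so a bound on `[0, t)` suffices; the first-exit argument
for uniqueness depends on this. -/
theorem norm_opConv_le {S : ℝ → E →L[ℝ] E} (hS : IntegrableOn S (Ioi 0)) {u : ℝ → E} {B t : ℝ}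
    (hB : 0 ≤ B) (ht : 0 ≤ t) (hu : ∀ s ∈ Ico 0 t, ‖u s‖ ≤ B) :
    ‖opConv S u t‖ ≤ (∫ s in Ioi (0 : ℝ), ‖S s‖) * B := by
  rw [opConv, intervalIntegral.integral_of_le ht, ← integral_mul_const]
  have hS' : IntegrableOn S (Ioc 0 t) := hS.mono_set Ioc_subset_Ioi_self
  refine (norm_integral_le_of_norm_le (hS'.norm.mul_const B) ?_).trans ?_
  · refine (ae_restrict_mem measurableSet_Ioc).mono fun s hs => ((S s).le_opNorm _).trans ?_
    exact mul_le_mul_of_nonneg_left (hu _ ⟨by linarith [hs.2], by linarith [hs.1]⟩) (norm_nonneg _)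
  · refine setIntegral_mono_set (hS.norm.mul_const B) ?_ Ioc_subset_Ioi_self.eventuallyLE
    exact Eventually.of_forall fun s => mul_nonneg (norm_nonneg _) hB

theorem opConv_sub {S : ℝ → E →L[ℝ] E} (hS : IntegrableOn S (Ioi 0)) {u v : ℝ → E} {t : ℝ}
    (ht : 0 ≤ t) (hu : ContinuousOn u (Icc 0 t)) (hv : ContinuousOn v (Icc 0 t)) :
    opConv S (fun s => u s - v s) t = opConv S u t - opConv S v t := by
  simp only [opConv, map_sub]
  exact intervalIntegral.integral_sub (intervalIntegrable_kernel_apply hS ht hu)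
    (intervalIntegrable_kernel_apply hS ht hv)

theorem opConv_const_add {S : ℝ → E →L[ℝ] E} (hS : IntegrableOn S (Ioi 0)) (c : E) {u : ℝ → E}
    {t : ℝ} (ht : 0 ≤ t) (hu : ContinuousOn u (Icc 0 t)) :
    opConv S (fun s => c + u s) t = (∫ s in 0..t, S s) c + opConv S u t := by
  simp only [opConv, map_add]
  rw [intervalIntegral.integral_add (intervalIntegrable_kernel_apply hS ht continuousOn_const)
    (intervalIntegrable_kernel_apply hS ht hu), ContinuousLinearMap.intervalIntegral_apply]
  exact (intervalIntegrable_iff_integrableOn_Ioc_of_le ht).2 (hS.mono_set Ioc_subset_Ioi_self)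

/-- If the nonlinearity has a small Lipschitz constant on a ball, the nonlinear Volterra equation has
at most one solution once it has a solution staying well inside of the ball. -/
theorem eqOn_of_volterra_eq {S : ℝ → E →L[ℝ] E} (hS : IntegrableOn S (Ioi 0)) {f : E → E}
    (hf : Continuous f) {K : NNReal} {r : ℝ} (hfK : LipschitzOnWith K f (Metric.closedBall 0 r))
    (hK : (∫ s in Ioi (0 : ℝ), ‖S s‖) * K ≤ 1 / 2) {x₀ c : E} {x y : ℝ → E} (hx : Continuous x)
    (hxr : ∀ t, ‖x t‖ < r)
    (hxe : ∀ t, 0 ≤ t → x t = x₀ + opConv S (fun s => c + f (x s)) t)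
    {T : ℝ} (hT : 0 < T) (hy : ContinuousOn y (Icc 0 T))
    (hye : ∀ t ∈ Icc 0 T, y t = x₀ + opConv S (fun s => c + f (y s)) t) :
    EqOn y x (Icc 0 T) := by
  -- While `y` stays in the ball, the maximum of `‖y - x‖` is at most half of itself, hence `0`.
  have hlocal : ∀ t₁ ∈ Icc 0 T, (∀ s ∈ Ico 0 t₁, ‖y s‖ < r) → EqOn y x (Icc 0 t₁) := by
    intro t₁ ht₁ hyr
    have hyt : ContinuousOn y (Icc 0 t₁) := hy.mono (Icc_subset_Icc_right ht₁.2)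
    obtain ⟨t, ht, hmax⟩ := isCompact_Icc.exists_isMaxOn (nonempty_Icc.2 ht₁.1)
      (hyt.sub hx.continuousOn).norm
    have hsub : Icc 0 t ⊆ Icc 0 t₁ := Icc_subset_Icc_right ht.2
    have hdiff : y t - x t = opConv S (fun s => f (y s) - f (x s)) t := by
      have hfy : ContinuousOn (fun s => f (y s)) (Icc 0 t) := hf.comp_continuousOn (hyt.mono hsub)
      have hfx : ContinuousOn (fun s => f (x s)) (Icc 0 t) := (hf.comp hx).continuousOn
      rw [opConv_sub hS ht.1 hfy hfx, hye t ⟨ht.1, ht.2.trans ht₁.2⟩, hxe t ht.1,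
        opConv_const_add hS c ht.1 hfy, opConv_const_add hS c ht.1 hfx]
      abel
    have hbound := norm_opConv_le hS (u := fun s => f (y s) - f (x s)) (B := K * ‖y t - x t‖)
      (by positivity) ht.1 fun s hs => by
        have h1 := hfK.norm_sub_le (x := y s) (y := x s)
          (by simpa using (hyr s ⟨hs.1, hs.2.trans_le ht.2⟩).le) (by simpa using (hxr s).le)
        refine h1.trans (mul_le_mul_of_nonneg_left ?_ K.2)
        exact hmax (show s ∈ Icc 0 t₁ from ⟨hs.1, hs.2.le.trans ht.2⟩)
    rw [← hdiff, ← mul_assoc] at hbound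
    have hzero : ‖y t - x t‖ ≤ 0 := by
      have := hbound.trans (mul_le_mul_of_nonneg_right hK (norm_nonneg _))
      linarith
    intro s hs
    have h2 : ‖y s - x s‖ ≤ ‖y t - x t‖ := hmax hs
    exact sub_eq_zero.1 (norm_le_zero_iff.1 (h2.trans hzero))
  -- At the first time `t₁` with `‖y t₁‖ ≥ r`, `hlocal` still gives `y t₁ = x t₁`, contradicting `‖x
  -- t₁‖ < r`.
  have hball : ∀ t ∈ Icc 0 T, ‖y t‖ < r := by
    by_contra! hcon
    obtain ⟨t₀, ht₀, hrt₀⟩ := hcon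
    have hclosed : IsClosed (Icc 0 T ∩ (fun t => ‖y t‖) ⁻¹' Ici r) :=
      hy.norm.preimage_isClosed_of_isClosed isClosed_Icc isClosed_Ici
    obtain ⟨t₁, ⟨ht₁, hrt₁⟩, hleast⟩ := (isCompact_Icc.of_isClosed_subset hclosed
      inter_subset_left).exists_isLeast ⟨t₀, ht₀, hrt₀⟩
    have h1 := hlocal t₁ ht₁ fun s hs => by
      by_contra! h
      exact absurd (hleast ⟨⟨hs.1, hs.2.le.trans ht₁.2⟩, h⟩) (not_le.2 hs.2)
    have hrt₁ : r ≤ ‖y t₁‖ := hrt₁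
    rw [h1 ⟨ht₁.1, le_rfl⟩] at hrt₁
    exact absurd (hxr t₁) (not_lt.2 hrt₁)
  exact hlocal T ⟨hT.le, le_rfl⟩ fun s hs => hball s ⟨hs.1, hs.2.le⟩

variable [CompleteSpace E]

open scoped ZeroAtInfty in
/-- A globally Lipschitz Volterra equation with a small Lipschitz constant has a solution vanishing
at infinity. -/
theorem exists_volterra_solution {S : ℝ → E →L[ℝ] E} (hS : IntegrableOn S (Ioi 0)) {A : E →L[ℝ] E}
    (hSA : (∫ s in Ioi (0 : ℝ), S s) * A = -1) {g : E → E} {K : NNReal} (hg : LipschitzWith K g)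
    (hg₀ : g 0 = 0) (hK : (∫ s in Ioi (0 : ℝ), ‖S s‖) * K ≤ 1 / 2) (x₀ : E) :
    ∃ x : ℝ → E, Continuous x ∧ Tendsto x atTop (𝓝 0) ∧
      (∀ t, ‖x t‖ ≤ 2 * ((1 + (∫ s in Ioi (0 : ℝ), ‖S s‖) * ‖A‖) * ‖x₀‖)) ∧
      ∀ t, 0 ≤ t → x t = x₀ + opConv S (fun s => A x₀ + g (x s)) t := by
  set C := ∫ s in Ioi (0 : ℝ), ‖S s‖ with hC
  have hC₀ : 0 ≤ C := integral_nonneg fun s => norm_nonneg _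
  have hgn : ∀ v, ‖g v‖ ≤ K * ‖v‖ := fun v => by simpa [hg₀] using hg.norm_sub_le v 0
  have hbdd : ∀ u : C₀(ℝ, E), ∀ s, ‖g (u s)‖ ≤ K * ‖u.toBCF‖ := fun u s =>
    (hgn _).trans (mul_le_mul_of_nonneg_left (u.toBCF.norm_coe_le_norm s) K.2)
  have hgc : ∀ u : C₀(ℝ, E), Continuous fun s => g (u s) := fun u => hg.continuous.comp u.continuous
  have habs : ∀ w : ℝ → E, ContinuousOn w (Ici 0) → Continuous fun t => w |t| := fun w hw =>
    hw.comp_continuous continuous_abs fun t => abs_nonneg t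
  have hu₀ : ∀ u : C₀(ℝ, E), Tendsto (fun s => g (u s)) atTop (𝓝 0) := fun u => by
    have h1 : Tendsto u atTop (𝓝 0) := u.zero_at_infty'.mono_left atTop_le_cocompact
    exact (hg.continuous.tendsto' 0 0 hg₀).comp h1
  -- The limit is `x₀ + (∫ S) A x₀ = x₀ - x₀`.
  have hlin : Tendsto (fun t => x₀ + (∫ s in 0..t, S s) (A x₀)) atTop (𝓝 0) := by
    have h1 : Tendsto (fun t => ∫ s in 0..t, S s) atTop (𝓝 (∫ s in Ioi (0 : ℝ), S s)) :=
      intervalIntegral_tendsto_integral_Ioi 0 hS tendsto_id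
    have h2 : Continuous fun R : E →L[ℝ] E => x₀ + R (A x₀) := by fun_prop
    refine (h2.tendsto' _ 0 ?_).comp h1
    have := congrArg (fun R : E →L[ℝ] E => R x₀) hSA
    simp only [mul_apply_eq_comp] at this
    rw [this]
    simp
  have hlinc : ContinuousOn (fun t => x₀ + (∫ s in 0..t, S s) (A x₀)) (Ici 0) :=
    continuousOn_const.add ((continuous_integral_kernel hS).clm_apply continuousOn_const)
  -- Extending evenly through `|t|` places the half-line problem in `C₀(ℝ, E)`, so decay of the
  -- solution is built into the complete space.
  let Φ : C₀(ℝ, E) → C₀(ℝ, E) := fun u =>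
    { toFun := fun t => (x₀ + (∫ s in 0..|t|, S s) (A x₀)) + opConv S (fun s => g (u s)) |t|
      continuous_toFun := (habs _ hlinc).add
        (habs _ (continuousOn_opConv_of_continuous hS (hgc u) (hbdd u)))
      zero_at_infty' := by
        have h1 := hlin.add (tendsto_opConv_atTop hS (hgc u) (hbdd u) (hu₀ u))
        rw [add_zero] at h1
        exact h1.comp (tendsto_norm_cocompact_atTop (E := ℝ)) }
  have hΦ : ContractingWith (1 / 2) Φ := by
    refine ⟨by norm_num, LipschitzWith.of_dist_le_mul fun u v => ?_⟩
    refine (BoundedContinuousFunction.dist_le (by positivity)).2 fun t => ?_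
    have h1 : Φ u t - Φ v t = opConv S (fun s => g (u s) - g (v s)) |t| := by
      rw [opConv_sub hS (abs_nonneg t) (hgc u).continuousOn (hgc v).continuousOn]
      exact add_sub_add_left_eq_sub _ _ _
    have h2 : ∀ s ∈ Ico 0 |t|, ‖g (u s) - g (v s)‖ ≤ K * dist u v := fun s _ => by
      refine (hg.norm_sub_le _ _).trans (mul_le_mul_of_nonneg_left ?_ K.2)
      rw [← dist_eq_norm]
      exact BoundedContinuousFunction.dist_coe_le_dist (f := u.toBCF) (g := v.toBCF) s
    change dist (Φ u t) (Φ v t) ≤ _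
    rw [dist_eq_norm, h1]
    refine (norm_opConv_le hS (by positivity) (abs_nonneg t) h2).trans ?_
    rw [← mul_assoc]
    exact (mul_le_mul_of_nonneg_right hK dist_nonneg).trans (by simp)
  set x := hΦ.fixedPoint Φ with hx
  have hfix : Φ x = x := hΦ.fixedPoint_isFixedPt
  have hval : ∀ t, x t = (x₀ + (∫ s in 0..|t|, S s) (A x₀)) + opConv S (fun s => g (x s)) |t| :=
    fun t => by
      conv_lhs => rw [← hfix]
      rfl
  refine ⟨x, x.continuous, x.zero_at_infty'.mono_left atTop_le_cocompact, ?_, fun t ht => ?_⟩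
  -- The term `1 / 2 * ‖x‖` is absorbed on the left, which accounts for the factor `2` in the bound.
  · have h1 : ∀ t, ‖x t‖ ≤ (1 + C * ‖A‖) * ‖x₀‖ + 1 / 2 * ‖x.toBCF‖ := by
      intro t
      rw [hval t]
      have e1 : ‖opConv S (fun s => g (x s)) |t|‖ ≤ C * (K * ‖x.toBCF‖) :=
        norm_opConv_le hS (by positivity) (abs_nonneg t) fun s _ => hbdd x s
      have e2 : ‖(∫ s in 0..|t|, S s) (A x₀)‖ ≤ C * (‖A‖ * ‖x₀‖) := by
        have := norm_opConv_le hS (u := fun _ => A x₀) (B := ‖A‖ * ‖x₀‖) (by positivity)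
          (abs_nonneg t) fun s _ => A.le_opNorm x₀
        rwa [opConv, ← ContinuousLinearMap.intervalIntegral_apply] at this
        exact (intervalIntegrable_iff_integrableOn_Ioc_of_le (abs_nonneg t)).2
          (hS.mono_set Ioc_subset_Ioi_self)
      have e3 := mul_le_mul_of_nonneg_right hK (norm_nonneg x.toBCF)
      have e4 := norm_add_le (x₀ + (∫ s in 0..|t|, S s) (A x₀)) (opConv S (fun s => g (x s)) |t|)
      have e5 := norm_add_le x₀ ((∫ s in 0..|t|, S s) (A x₀))
      linarith
    have h2 : ‖x.toBCF‖ ≤ (1 + C * ‖A‖) * ‖x₀‖ + 1 / 2 * ‖x.toBCF‖ :=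
      (BoundedContinuousFunction.norm_le (by positivity)).2 h1
    intro t
    have := x.toBCF.norm_coe_le_norm t
    have h3 : ‖x t‖ ≤ ‖x.toBCF‖ := this
    linarith
  · rw [opConv_const_add hS _ ht (hgc x).continuousOn, hval t, abs_of_nonneg ht, add_assoc]

/-- Global existence, smallness, decay and uniqueness for the Volterra equation with small initial
values. -/
theorem exists_unique_small_volterra_solution [FiniteDimensional ℝ E] {S : ℝ → E →L[ℝ] E}
    (hS : IntegrableOn S (Ioi 0)) {A : E →L[ℝ] E}
    (hSA : (∫ s in Ioi (0 : ℝ), S s) * A = -1) {f : E → E} (hf : Continuous f) (hf₀ : f 0 = 0)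
    (hlim : Tendsto (lipConst f) (𝓝[>] 0) (𝓝 0)) {ε : ℝ} (hε : 0 < ε) :
    ∃ δ > 0, ∀ x₀ : E, ‖x₀‖ ≤ δ → ∃ x : ℝ → E, Continuous x ∧ (∀ t, ‖x t‖ ≤ ε) ∧
      Tendsto x atTop (𝓝 0) ∧ (∀ t, 0 ≤ t → x t = x₀ + opConv S (fun s => A x₀ + f (x s)) t) ∧
      ∀ T : ℝ, 0 < T → ∀ y : ℝ → E, ContinuousOn y (Icc 0 T) →
        (∀ t ∈ Icc 0 T, y t = x₀ + opConv S (fun s => A x₀ + f (y s)) t) →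
        EqOn y x (Icc 0 T) := by
  set C := ∫ s in Ioi (0 : ℝ), ‖S s‖ with hC
  have hC₀ : 0 ≤ C := integral_nonneg fun s => norm_nonneg _
  set Λ := lipschitzExtensionConstant E with hΛ
  have hΛ₀ : 0 < Λ := lipschitzExtensionConstant_pos E
  -- Chosen so that `C * η ≤ 1 / 2` for `f` on the ball (uniqueness) and `C * Λ * η ≤ 1 / 2` for its
  -- global extension `g`, whose Lipschitz constant grows by `Λ` (existence).
  set η : NNReal := Real.toNNReal (1 / (2 * (C + 1) * (Λ + 1))) with hη
  have hη₀ : 0 < η := Real.toNNReal_pos.2 (by positivity)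
  have hηv : (η : ℝ) = 1 / (2 * (C + 1) * (Λ + 1)) := Real.coe_toNNReal _ (by positivity)
  obtain ⟨r, hr, hfr⟩ := exists_lipschitzOnWith_of_lipConst hlim hη₀
  obtain ⟨g, hg, hgf⟩ := hfr.extend_finite_dimension
  have hKg : C * ((Λ * η : NNReal) : ℝ) ≤ 1 / 2 := by
    rw [NNReal.coe_mul, hηv]
    have hΛ' : (0 : ℝ) ≤ Λ := Λ.2
    rw [mul_one_div, ← mul_div_assoc, div_le_div_iff₀ (by positivity) two_pos]
    nlinarith
  have hKf : C * (η : ℝ) ≤ 1 / 2 := by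
    rw [hηv]
    have hΛ' : (0 : ℝ) ≤ Λ := Λ.2
    rw [mul_one_div, div_le_div_iff₀ (by positivity) two_pos]
    nlinarith [mul_nonneg hC₀ hΛ']
  have hg₀ : g 0 = 0 := by
    rw [← hgf (Metric.mem_closedBall_self hr.le), hf₀]
  have hε' : 0 < min ε (r / 2) := lt_min hε (half_pos hr)
  -- The a priori bound of the fixed point becomes `min ε (r / 2)`. The solution then lies strictly
  -- inside the ball of radius `r`, where `g = f`.
  refine ⟨min ε (r / 2) / (2 * (1 + C * ‖A‖)), by positivity, fun x₀ hx₀ => ?_⟩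
  obtain ⟨x, hxc, hxt, hxb, hxe⟩ := exists_volterra_solution hS hSA hg hg₀ hKg x₀
  have hxε : ∀ t, ‖x t‖ ≤ min ε (r / 2) := fun t => by
    refine (hxb t).trans ?_
    rw [le_div_iff₀ (by positivity)] at hx₀
    linarith
  have hxr : ∀ t, ‖x t‖ < r := fun t =>
    ((hxε t).trans (min_le_right _ _)).trans_lt (half_lt_self hr)
  have hfg : ∀ t, g (x t) = f (x t) := fun t => (hgf (by simpa using (hxr t).le)).symm
  simp_rw [hfg] at hxe
  exact ⟨x, hxc, fun t => (hxε t).trans (min_le_left _ _), hxt, hxe, fun T hT y hy hye =>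
    eqOn_of_volterra_eq hS hf hfr hKf hxc hxr hxe hT hy hye⟩

end FixedPoint

/-! ### Reduction to the Caputo derivative by a time change -/

section TimeChange

/-- The time change turning the Caputo–Katugampola derivative into the Caputo derivative. -/
noncomputable def timeChange (ρ t₀ t : ℝ) : ℝ := (t ^ ρ - t₀ ^ ρ) / ρ

/-- The inverse of `timeChange`. -/
noncomputable def timeChangeInv (ρ t₀ τ : ℝ) : ℝ := (ρ * τ + t₀ ^ ρ) ^ ρ⁻¹

variable {ρ t₀ : ℝ}

theorem timeChange_self : timeChange ρ t₀ t₀ = 0 := by simp [timeChange]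

theorem timeChange_le (hρ : 0 < ρ) (ht₀ : 0 < t₀) {s t : ℝ} (hs : t₀ ≤ s) (hst : s ≤ t) :
    timeChange ρ t₀ s ≤ timeChange ρ t₀ t := by
  have := Real.rpow_le_rpow (ht₀.le.trans hs) hst hρ.le
  unfold timeChange
  gcongr

theorem timeChange_lt (hρ : 0 < ρ) (ht₀ : 0 < t₀) {s t : ℝ} (hs : t₀ ≤ s) (hst : s < t) :
    timeChange ρ t₀ s < timeChange ρ t₀ t := by
  have := Real.rpow_lt_rpow (ht₀.le.trans hs) hst hρ
  unfold timeChange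
  gcongr

theorem timeChange_nonneg (hρ : 0 < ρ) (ht₀ : 0 < t₀) {t : ℝ} (ht : t₀ ≤ t) :
    0 ≤ timeChange ρ t₀ t :=
  timeChange_self.symm.le.trans (timeChange_le hρ ht₀ le_rfl ht)

theorem timeChangeInv_timeChange (hρ : 0 < ρ) (ht₀ : 0 < t₀) {t : ℝ} (ht : t₀ ≤ t) :
    timeChangeInv ρ t₀ (timeChange ρ t₀ t) = t := by
  rw [timeChange, timeChangeInv, mul_div_cancel₀ _ hρ.ne', sub_add_cancel,
    Real.rpow_rpow_inv (ht₀.le.trans ht) hρ.ne']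

theorem timeChange_timeChangeInv (hρ : 0 < ρ) (ht₀ : 0 < t₀) {τ : ℝ} (hτ : 0 ≤ τ) :
    timeChange ρ t₀ (timeChangeInv ρ t₀ τ) = τ := by
  rw [timeChange, timeChangeInv, Real.rpow_inv_rpow (by positivity) hρ.ne', add_sub_cancel_right,
    mul_div_cancel_left₀ _ hρ.ne']

theorem timeChangeInv_zero (hρ : 0 < ρ) (ht₀ : 0 < t₀) : timeChangeInv ρ t₀ 0 = t₀ := by
  rw [← timeChange_self (ρ := ρ) (t₀ := t₀), timeChangeInv_timeChange hρ ht₀ le_rfl]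

theorem timeChangeInv_le (hρ : 0 < ρ) (ht₀ : 0 < t₀) {σ τ : ℝ} (hσ : 0 ≤ σ) (h : σ ≤ τ) :
    timeChangeInv ρ t₀ σ ≤ timeChangeInv ρ t₀ τ := by
  unfold timeChangeInv
  have : 0 ≤ ρ * σ + t₀ ^ ρ := by positivity
  gcongr

theorem le_timeChangeInv (hρ : 0 < ρ) (ht₀ : 0 < t₀) {τ : ℝ} (hτ : 0 ≤ τ) :
    t₀ ≤ timeChangeInv ρ t₀ τ := by
  conv_lhs => rw [← timeChangeInv_zero hρ ht₀]
  exact timeChangeInv_le hρ ht₀ le_rfl hτ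

theorem continuous_timeChange (hρ : 0 < ρ) : Continuous (timeChange ρ t₀) :=
  ((Real.continuous_rpow_const hρ.le).sub continuous_const).div_const ρ

theorem continuous_timeChangeInv (hρ : 0 < ρ) : Continuous (timeChangeInv ρ t₀) :=
  (Real.continuous_rpow_const (inv_nonneg.2 hρ.le)).comp (by fun_prop)

theorem tendsto_timeChange (hρ : 0 < ρ) : Tendsto (timeChange ρ t₀) atTop atTop := by
  have h := tendsto_atTop_add_const_right atTop (-(t₀ ^ ρ)) (tendsto_rpow_atTop hρ)
  have e : timeChange ρ t₀ = fun t => (t ^ ρ + -(t₀ ^ ρ)) / ρ := by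
    ext t
    simp [timeChange, sub_eq_add_neg]
  rw [e]
  exact h.atTop_div_const hρ

theorem hasDerivAt_timeChange (hρ : 0 < ρ) {t : ℝ} (ht : 0 < t) :
    HasDerivAt (timeChange ρ t₀) (t ^ (ρ - 1)) t := by
  have h := ((Real.hasDerivAt_rpow_const (p := ρ) (Or.inl ht.ne')).sub_const (t₀ ^ ρ)).div_const ρ
  rwa [mul_div_cancel_left₀ _ hρ.ne'] at h

variable {E : Type*} [NormedAddCommGroup E] [NormedSpace ℝ E]

/-- Substitution with `dτ = s ^ (ρ - 1) ds`. Injectivity on the interval makes it valid for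
arbitrary `G`, with no regularity to check for the singular kernel. -/
theorem integral_timeChange (hρ : 0 < ρ) (ht₀ : 0 < t₀) (G : ℝ → E) {t : ℝ} (ht : t₀ ≤ t) :
    ∫ s in t₀..t, s ^ (ρ - 1) • G (timeChange ρ t₀ s) = ∫ w in 0..timeChange ρ t₀ t, G w := by
  have himage : timeChange ρ t₀ '' Icc t₀ t = Icc 0 (timeChange ρ t₀ t) := by
    ext w
    constructor
    · rintro ⟨s, hs, rfl⟩
      exact ⟨timeChange_nonneg hρ ht₀ hs.1, timeChange_le hρ ht₀ hs.1 hs.2⟩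
    · rintro hw
      refine ⟨timeChangeInv ρ t₀ w, ⟨le_timeChangeInv hρ ht₀ hw.1, ?_⟩,
        timeChange_timeChangeInv hρ ht₀ hw.1⟩
      rw [← timeChangeInv_timeChange hρ ht₀ ht]
      exact timeChangeInv_le hρ ht₀ hw.1 hw.2
  have hinj : InjOn (timeChange ρ t₀) (Icc t₀ t) := fun s hs s' hs' h => by
    rw [← timeChangeInv_timeChange hρ ht₀ hs.1, h, timeChangeInv_timeChange hρ ht₀ hs'.1]
  have h := integral_image_eq_integral_abs_deriv_smul measurableSet_Icc
    (fun s (hs : s ∈ Icc t₀ t) =>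
      (hasDerivAt_timeChange (t₀ := t₀) hρ (ht₀.trans_le hs.1)).hasDerivWithinAt) hinj G
  rw [himage, integral_Icc_eq_integral_Ioc, integral_Icc_eq_integral_Ioc,
    ← intervalIntegral.integral_of_le (timeChange_nonneg hρ ht₀ ht),
    ← intervalIntegral.integral_of_le ht] at h
  rw [h]
  refine intervalIntegral.integral_congr fun s hs => ?_
  rw [uIcc_of_le ht] at hs
  simp only [abs_of_nonneg (Real.rpow_nonneg (ht₀.le.trans hs.1) _)]

/-- The Katugampola integral is an Abel integral after the time change. -/
theorem integral_katugampola_eq {α : ℝ} (hα₁ : α < 1) (hρ : 0 < ρ) (ht₀ : 0 < t₀) (v : ℝ → E)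
    {t : ℝ} (ht : t₀ ≤ t) :
    ∫ s in t₀..t, (s ^ (ρ - 1) / (t ^ ρ - s ^ ρ) ^ α) • v (timeChange ρ t₀ s) =
      (Real.Gamma (1 - α) / ρ ^ α) •
        ∫ w in 0..timeChange ρ t₀ t, abelKernel α w • v (timeChange ρ t₀ t - w) := by
  set θ := timeChange ρ t₀ t with hθ
  have hθ₀ : 0 ≤ θ := timeChange_nonneg hρ ht₀ ht
  have h1 : ∀ s, (s ^ (ρ - 1) / (t ^ ρ - s ^ ρ) ^ α) • v (timeChange ρ t₀ s) =
      s ^ (ρ - 1) • (fun w => ((ρ * (θ - w)) ^ α)⁻¹ • v w) (timeChange ρ t₀ s) := by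
    intro s
    have : ρ * (θ - timeChange ρ t₀ s) = t ^ ρ - s ^ ρ := by
      rw [hθ, timeChange, timeChange]
      field_simp
      ring
    simp only [this, smul_smul, div_eq_mul_inv]
  simp_rw [h1]
  rw [integral_timeChange hρ ht₀ (fun w => ((ρ * (θ - w)) ^ α)⁻¹ • v w) ht,
    ← intervalIntegral.integral_smul, ← hθ]
  have h2 := intervalIntegral.integral_comp_sub_left
    (fun w => ((ρ * (θ - w)) ^ α)⁻¹ • v w) (a := 0) (b := θ) θ
  simp only [sub_zero, sub_self, sub_sub_cancel] at h2
  rw [← h2]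
  refine intervalIntegral.integral_congr fun w hw => ?_
  rw [uIcc_of_le hθ₀] at hw
  have hΓ : Real.Gamma (1 - α) ≠ 0 := (Real.Gamma_pos_of_pos (by linarith)).ne'
  simp only [smul_smul, abelKernel]
  congr 1
  rw [Real.mul_rpow hρ.le hw.1, Real.rpow_neg hw.1, mul_inv]
  field_simp

variable [CompleteSpace E]

/-- A solution satisfies the integrated equation in the new time. -/
theorem IsSolution.integral_abelKernel_eq {α : ℝ} (hα₁ : α < 1) (hρ : 0 < ρ)
    (ht₀ : 0 < t₀) {g : E → E} (hg : Continuous g) {x₀ : E} {R : EReal} {y : ℝ → E}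
    (hy : IsSolution α ρ t₀ g x₀ R y) {t : ℝ} (ht : t₀ ≤ t) (htR : (t : EReal) < R) :
    ∫ w in 0..timeChange ρ t₀ t,
      abelKernel α w • (y (timeChangeInv ρ t₀ (timeChange ρ t₀ t - w)) - x₀) =
    ∫ w in 0..timeChange ρ t₀ t, g (y (timeChangeInv ρ t₀ w)) := by
  have hΓ : 0 < Real.Gamma (1 - α) := Real.Gamma_pos_of_pos (by linarith)
  have hρα : 0 < ρ ^ α := Real.rpow_pos_of_pos hρ α
  set c := Real.Gamma (1 - α) / ρ ^ α with hc
  have hc₀ : c ≠ 0 := (div_pos hΓ hρα).ne'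
  set F : ℝ → E := fun τ => ∫ s in t₀..τ, (s ^ (ρ - 1) / (τ ^ ρ - s ^ ρ) ^ α) • (y s - y t₀)
    with hF
  have hR : ∀ s ∈ Icc t₀ t, (s : EReal) < R := fun s hs =>
    (EReal.coe_le_coe_iff.2 hs.2).trans_lt htR
  have hderiv : ∀ s ∈ Icc t₀ t,
      HasDerivWithinAt F (c • (s ^ (ρ - 1) • g (y s))) (Ici t₀) s := by
    intro s hs
    obtain ⟨w, hw, hv⟩ := hy.equation s hs.1 (hR s hs)
    have hs₀ : 0 < s := ht₀.trans_le hs.1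
    convert hw using 1
    rw [hv, smul_smul, smul_smul]
    have h1 : s ^ (ρ - 1) * s ^ (1 - ρ) = 1 := by
      rw [← Real.rpow_add hs₀]
      simp
    have h2 : c * (s ^ (ρ - 1) * (ρ ^ α / Real.Gamma (1 - α) * s ^ (1 - ρ))) = 1 := by
      rw [hc]
      calc _ = (Real.Gamma (1 - α) / ρ ^ α * (ρ ^ α / Real.Gamma (1 - α))) *
            (s ^ (ρ - 1) * s ^ (1 - ρ)) := by ring
        _ = 1 := by
          rw [h1]
          field_simp
    rw [mul_assoc, h2, one_smul]
  have hyc : ContinuousOn y (Icc t₀ t) := hy.continuousOn.mono fun s hs => ⟨hs.1, hR s hs⟩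
  have hcont : ContinuousOn (fun s => c • (s ^ (ρ - 1) • g (y s))) (Icc t₀ t) := by
    refine ContinuousOn.const_smul (ContinuousOn.smul ?_ (hg.comp_continuousOn hyc)) c
    exact continuousOn_id.rpow_const fun s hs => Or.inl (ht₀.trans_le hs.1).ne'
  -- The equation prescribes a continuous derivative for `F`, and `F t₀ = 0`, so `F` is recovered by
  -- integration.
  have hFTC := intervalIntegral.integral_eq_sub_of_hasDeriv_right_of_le ht
    (f := F) (f' := fun s => c • (s ^ (ρ - 1) • g (y s)))
    (fun s hs => (hderiv s hs).continuousWithinAt.mono Icc_subset_Ici_self)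
    (fun s hs => (hderiv s (Ioo_subset_Icc_self hs)).mono fun r hr => (hs.1.trans hr).le)
    (hcont.intervalIntegrable_of_Icc ht)
  have hF₀ : F t₀ = 0 := by simp [hF]
  rw [hF₀, sub_zero, intervalIntegral.integral_smul] at hFTC
  have h1 : F t = c • ∫ w in 0..timeChange ρ t₀ t,
      abelKernel α w • (y (timeChangeInv ρ t₀ (timeChange ρ t₀ t - w)) - x₀) := by
    rw [← integral_katugampola_eq hα₁ hρ ht₀ (fun w => y (timeChangeInv ρ t₀ w) - x₀) ht]
    refine intervalIntegral.integral_congr fun s hs => ?_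
    rw [uIcc_of_le ht] at hs
    simp only [timeChangeInv_timeChange hρ ht₀ hs.1, hy.initial]
  have h2 : ∫ s in t₀..t, s ^ (ρ - 1) • g (y s) =
      ∫ w in 0..timeChange ρ t₀ t, g (y (timeChangeInv ρ t₀ w)) := by
    rw [← integral_timeChange hρ ht₀ (fun w => g (y (timeChangeInv ρ t₀ w))) ht]
    refine intervalIntegral.integral_congr fun s hs => ?_
    rw [uIcc_of_le ht] at hs
    simp only [timeChangeInv_timeChange hρ ht₀ hs.1]
  rw [h1, h2] at hFTC
  exact (smul_right_injective E hc₀ hFTC).symm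

/-- A solution of the integrated equation gives a global solution in the original time. -/
theorem isSolution_of_integral_abelKernel_eq {α : ℝ} (hα₁ : α < 1) (hρ : 0 < ρ)
    (ht₀ : 0 < t₀) {g : E → E} (hg : Continuous g) {x₀ : E} {v : ℝ → E} (hv : Continuous v)
    (hv₀ : v 0 = x₀)
    (h : ∀ τ, 0 ≤ τ → ∫ w in 0..τ, abelKernel α w • (v (τ - w) - x₀) = ∫ w in 0..τ, g (v w)) :
    IsSolution α ρ t₀ g x₀ ⊤ fun t => v (timeChange ρ t₀ t) := by
  have hΓ : 0 < Real.Gamma (1 - α) := Real.Gamma_pos_of_pos (by linarith)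
  have hρα : 0 < ρ ^ α := Real.rpow_pos_of_pos hρ α
  set c := Real.Gamma (1 - α) / ρ ^ α with hc
  have hvt : Continuous fun t => v (timeChange ρ t₀ t) := hv.comp (continuous_timeChange hρ)
  refine ⟨EReal.coe_lt_top t₀, hvt.continuousOn, by simp only [timeChange_self, hv₀],
    fun t ht _ => ?_⟩
  have ht' : 0 < t := ht₀.trans_le ht
  have hcont : ContinuousOn (fun s => s ^ (ρ - 1) • g (v (timeChange ρ t₀ s))) (Ioi 0) := by
    refine ContinuousOn.smul ?_ (hg.comp hvt).continuousOn
    exact continuousOn_id.rpow_const fun s hs => Or.inl (ne_of_gt hs)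
  have hP : HasDerivAt (fun τ => ∫ s in t₀..τ, s ^ (ρ - 1) • g (v (timeChange ρ t₀ s)))
      (t ^ (ρ - 1) • g (v (timeChange ρ t₀ t))) t :=
    intervalIntegral.integral_hasDerivAt_right
      ((hcont.mono fun s hs => ht₀.trans_le hs.1).intervalIntegrable_of_Icc ht)
      (hcont.stronglyMeasurableAtFilter isOpen_Ioi t ht')
      (hcont.continuousAt (Ioi_mem_nhds ht'))
  -- The identity is needed only for `τ ≥ t₀`, since the derivative is taken within `[t₀, ∞)`; it
  -- presents the singular integral as a differentiable primitive.
  have hF : ∀ τ ∈ Ici t₀, ∫ s in t₀..τ, (s ^ (ρ - 1) / (τ ^ ρ - s ^ ρ) ^ α) •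
      (v (timeChange ρ t₀ s) - v (timeChange ρ t₀ t₀)) =
      c • ∫ s in t₀..τ, s ^ (ρ - 1) • g (v (timeChange ρ t₀ s)) := by
    intro τ hτ
    rw [timeChange_self, hv₀, integral_katugampola_eq hα₁ hρ ht₀ (fun w => v w - x₀) hτ,
      h _ (timeChange_nonneg hρ ht₀ hτ), integral_timeChange hρ ht₀ (fun w => g (v w)) hτ]
  refine ⟨c • (t ^ (ρ - 1) • g (v (timeChange ρ t₀ t))),
    ((hP.const_smul c).hasDerivWithinAt).congr hF (hF t ht), ?_⟩
  rw [smul_smul, smul_smul]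
  have h1 : t ^ (1 - ρ) * t ^ (ρ - 1) = 1 := by
    rw [← Real.rpow_add ht']
    simp
  have h2 : ρ ^ α / Real.Gamma (1 - α) * t ^ (1 - ρ) * c * t ^ (ρ - 1) = 1 := by
    rw [hc]
    calc _ = (Real.Gamma (1 - α) / ρ ^ α * (ρ ^ α / Real.Gamma (1 - α))) *
          (t ^ (1 - ρ) * t ^ (ρ - 1)) := by ring
      _ = 1 := by
        rw [h1]
        field_simp
  rw [h2, one_smul]

end TimeChange

/-! ### Maximal solutions for small initial values -/

section Stability

variable {E : Type*} [NormedAddCommGroup E] [NormedSpace ℝ E] [FiniteDimensional ℝ E]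

/-- Global existence, smallness, decay and uniqueness for small initial values. -/
theorem exists_maximalSolution {α ρ t₀ : ℝ} (hα₁ : α < 1) (hρ : 0 < ρ) (ht₀ : 0 < t₀)
    {A : E →L[ℝ] E} {S : ℝ → E →L[ℝ] E} (hS : IntegrableOn S (Ioi 0))
    (hSA : (∫ t in Ioi (0 : ℝ), S t) * A = -1)
    (hl : ∀ᵐ t, t ∈ Ioi (0 : ℝ) →
      ∫ s in 0..t, abelKernel α s • S (t - s) = 1 + A * ∫ s in 0..t, S s)
    (hr : ∀ᵐ t, t ∈ Ioi (0 : ℝ) →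
      ∫ s in 0..t, abelKernel α s • S (t - s) = 1 + (∫ s in 0..t, S s) * A)
    {f : E → E} (hf : Continuous f) (hf₀ : f 0 = 0)
    (hlim : Tendsto (lipConst f) (𝓝[>] 0) (𝓝 0)) {ε : ℝ} (hε : 0 < ε) :
    ∃ δ > 0, ∀ x₀ : E, ‖x₀‖ ≤ δ → ∃ x : ℝ → E,
      IsMaximalSolution α ρ t₀ (fun x => A x + f x) x₀ ⊤ x ∧ (∀ t, ‖x t‖ ≤ ε) ∧
      Tendsto x atTop (𝓝 0) := by
  have : CompleteSpace E := FiniteDimensional.complete ℝ E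
  have hk := integrableOn_abelKernel hα₁
  have hg : Continuous fun x => A x + f x := A.continuous.add hf
  obtain ⟨δ, hδ, H⟩ := exists_unique_small_volterra_solution hS hSA hf hf₀ hlim hε
  refine ⟨δ, hδ, fun x₀ hx₀ => ?_⟩
  obtain ⟨x, hxc, hxε, hxt, hxe, huniq⟩ := H x₀ hx₀
  have hx0 : x 0 = x₀ := by
    rw [hxe 0 le_rfl]
    simp [opConv]
  have hsol : IsSolution α ρ t₀ (fun x => A x + f x) x₀ ⊤ fun t => x (timeChange ρ t₀ t) := by
    refine isSolution_of_integral_abelKernel_eq hα₁ hρ ht₀ hg hxc hx0 fun τ hτ => ?_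
    -- For `y = x - x₀` and `h = A x₀ + f x` the linear right side `A y + h` is `A x + f x`.
    have h1 := integral_smul_eq_of_eq_opConv hk hS hl (T := τ) (y := fun s => x s - x₀)
      (h := fun s => A x₀ + f (x s)) (by fun_prop)
      (fun s hs => by simp only [hxe s hs.1, add_sub_cancel_left]) ⟨hτ, le_rfl⟩
    rw [h1]
    refine intervalIntegral.integral_congr fun s _ => ?_
    simp only [map_sub]
    abel
  refine ⟨fun t => x (timeChange ρ t₀ t), ⟨hsol, fun R y hy => ⟨le_top, fun t ht => ?_⟩⟩,
    fun t => hxε _, hxt.comp (tendsto_timeChange hρ)⟩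
  -- Uniqueness for the Volterra equation requires an interval of positive length, so `t = t₀` is
  -- settled by the initial value.
  rcases ht.1.eq_or_lt with rfl | htt
  · simp only [timeChange_self, hx0, hy.initial]
  · set T := timeChange ρ t₀ t with hT
    have hT₀ : 0 < T := by
      rw [hT, ← timeChange_self (ρ := ρ) (t₀ := t₀)]
      exact timeChange_lt hρ ht₀ le_rfl htt
    -- The competing solution in the new time; on `[0, T]` it satisfies the same Volterra equation
    -- as `x`.
    set v : ℝ → E := fun τ => y (timeChangeInv ρ t₀ τ) with hv
    have htime : ∀ τ ∈ Icc 0 T, t₀ ≤ timeChangeInv ρ t₀ τ ∧ timeChangeInv ρ t₀ τ ≤ t :=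
      fun τ hτ => ⟨le_timeChangeInv hρ ht₀ hτ.1, by
        rw [← timeChangeInv_timeChange hρ ht₀ ht.1]
        exact timeChangeInv_le hρ ht₀ hτ.1 hτ.2⟩
    have htR : ∀ τ ∈ Icc 0 T, ((timeChangeInv ρ t₀ τ : ℝ) : EReal) < R := fun τ hτ =>
      (EReal.coe_le_coe_iff.2 (htime τ hτ).2).trans_lt ht.2
    have hvc : ContinuousOn v (Icc 0 T) :=
      hy.continuousOn.comp (continuous_timeChangeInv hρ).continuousOn fun τ hτ =>
        ⟨(htime τ hτ).1, htR τ hτ⟩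
    have hint : ∀ τ ∈ Icc 0 T, ∫ w in 0..τ, abelKernel α w • (v (τ - w) - x₀) =
        ∫ w in 0..τ, (A (v w - x₀) + (A x₀ + f (v w))) := by
      intro τ hτ
      have h1 := hy.integral_abelKernel_eq hα₁ hρ ht₀ hg (htime τ hτ).1 (htR τ hτ)
      rw [timeChange_timeChangeInv hρ ht₀ hτ.1] at h1
      rw [h1]
      refine intervalIntegral.integral_congr fun s _ => ?_
      simp only [map_sub, hv]
      abel
    have hrep := eq_opConv_of_integral_smul_eq hk hS hr hT₀ (y := fun s => v s - x₀)
      (h := fun s => A x₀ + f (v s)) (continuousOn_const.add (hf.comp_continuousOn hvc))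
      (hvc.sub continuousOn_const) hint
    have heq := huniq T hT₀ v hvc fun τ hτ => by
      rw [← hrep hτ]
      exact (add_sub_cancel x₀ (v τ)).symm
    have h3 : y (timeChangeInv ρ t₀ (timeChange ρ t₀ t)) = x (timeChange ρ t₀ t) :=
      heq ⟨hT₀.le, le_rfl⟩
    rwa [timeChangeInv_timeChange hρ ht₀ ht.1] at h3

end Stability

end CaputoKatugampola

theorem theorem3p1 (d : ℕ) (α ρ t₀ : ℝ) (hα₀ : 0 < α) (hα₁ : α < 1) (hρ : 0 < ρ) (ht₀ : 0 < t₀)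
    (A : Matrix (Fin d) (Fin d) ℝ)
    (hA : ∀ μ ∈ spectrum ℂ (A.map (algebraMap ℝ ℂ)), α * Real.pi / 2 < |Complex.arg μ|)
    (f : EuclideanSpace ℝ (Fin d) → EuclideanSpace ℝ (Fin d))
    (hf : LocallyLipschitz f) (hf₀ : f 0 = 0)
    (hlim : Filter.Tendsto (CaputoKatugampola.lipConst f) (nhdsWithin 0 (Set.Ioi 0)) (nhds 0)) :
    CaputoKatugampola.IsAsymptoticallyStable α ρ t₀
      (fun x => Matrix.toEuclideanLin A x + f x) := by
  obtain ⟨S, hS, hSA, hl, hr⟩ := CaputoKatugampola.exists_integrableOn_real_kernel hα₀ hα₁ A hA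
  have H := fun ε (hε : 0 < ε) => CaputoKatugampola.exists_maximalSolution (ε := ε) hα₁ hρ ht₀ hS
    hSA hl hr hf.continuous hf₀ hlim hε
  constructor
  · intro ε hε
    obtain ⟨δ, hδ, h⟩ := H ε hε
    refine ⟨δ, hδ, fun x₀ hx₀ => ?_⟩
    obtain ⟨x, hx, hxε, -⟩ := h x₀ hx₀
    exact ⟨⊤, x, hx, rfl, fun t _ => hxε t⟩
  · obtain ⟨δ, hδ, h⟩ := H 1 one_pos
    refine ⟨δ, hδ, fun x₀ hx₀ => ?_⟩
    obtain ⟨x, hx, -, hxt⟩ := h x₀ hx₀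
    exact ⟨⊤, x, hx, rfl, hxt⟩
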